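/- Let $X$ be a connected simple graph with vertex set $VX$, possibly infinite, of bounded valency (there is $M$ such that every vertex has at most $M$ neighbours). Let $\mathrm{OE}$ be the set of oriented edges of $X$; for $e\in\mathrm{OE}$ write $o(e)$ and $t(e)$ for its origin and target and $e^{-1}$ for its reverse. Let $w:\mathrm{OE}\to(0,\infty)$ be a weight function of finite total weight, $\sum_{e\in\mathrm{OE}}w(e)<\infty$. A closed path of length $n\ge 1$ is a sequence of vertices $p=(x_0,x_1,\dots,x_n)$ with $x_n=x_0$ and with $x_j,x_{j+1}$ adjacent for $0\le j\le n-1$; it is reduced if $x_{j-1}\ne x_{j+1}$ for $1\le j\le n-1$. Its weight is $w(p)=w(x_0,x_1)\cdots w(x_{n-1},x_n)$, and its $j$-th power ($j\geq 1$) is the closed path which runs through $p$ $j$ times. Call closed paths equivalent under the equivalence relation generated by $(x_0,\dots,x_n)\sim(x_1,\dots,x_n,x_1)$. A cycle is an equivalence class that consists of reduced closed paths only; length $l$, weight $w$ and powers are well defined on classes. A cycle is prime if it is not a power of a shorter cycle. The Ihara zeta function of $(X,w)$ is the product over all prime cycles $$Z(u)=\prod_p\bigl(1-w(p)u^{l(p)}\bigr)^{-1}.$$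 Let $T$ be the bounded operator on the Hilbert space $\ell^2(\mathrm{OE})$ with orthonormal basis $(e)_{e\in\mathrm{OE}}$ given by $$Te=\sum_{e'\in\mathrm{OE}:\ o(e')=t(e),\ e'\neq e^{-1}}w(e')\,e'.$$ For a trace class operator $S$ on a Hilbert space the Fredholm determinant is $\det(1-S)=\sum_{k=0}^\infty(-1)^k\operatorname{tr}\bigl(\bigwedge^kS\bigr)$. Then $T$ is of trace class. The infinite product $Z(u)$ converges (to a nonzero limit) for $|u|$ sufficiently small. The limit function extends to a meromorphic function $Z$ on $\mathbb C$ without zeros; more precisely, $Z(u)^{-1}$ is an entire function and for all $u\in\mathbb C$ $$Z(u)^{-1}=\det(1-uT).$$ -/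

import Mathlib

noncomputable section

/-! ### Exterior powers of a complex Hilbert space -/

namespace HilbertExterior

open Matrix

theorem card_factorial_mul_det_mul {k m : Type*} [Fintype k] [DecidableEq k] [Fintype m]
    (A : Matrix k m ℂ) (B : Matrix m k ℂ) :
    ((Fintype.card k).factorial : ℂ) * (A * B).det =
      ∑ s : k → m, (A.submatrix id s).det * (B.submatrix s id).det := by
  classical
  have h1 : (A * B).det = ∑ s : k → m, (∏ i, A i (s i)) * (B.submatrix s id).det := by
    have hrow : (A * B) = fun i => ∑ j, A i j • B j := by
      ext i l; simp [Matrix.mul_apply]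
    have := (detRowAlternating (n := k) (R := ℂ)).toMultilinearMap.map_sum (fun i j => A i j • B j)
    change (detRowAlternating (n := k) (R := ℂ)) (A * B) = _
    rw [hrow]
    refine this.trans (Finset.sum_congr rfl fun s _ => ?_)
    exact ((detRowAlternating (n := k) (R := ℂ)).toMultilinearMap.map_smul_univ
      (fun i => A i (s i)) (fun i => B (s i)))
  have h2 : ∀ σ : Equiv.Perm k, (A * B).det =
      ∑ s : k → m, (((Equiv.Perm.sign σ : ℤ) : ℂ) * ∏ i, A i (s (σ i))) *
        (B.submatrix s id).det := by
    intro σ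
    rw [h1, ← (Equiv.arrowCongr σ.symm (Equiv.refl m)).sum_comp]
    refine Finset.sum_congr rfl fun s _ => ?_
    have hd : (B.submatrix (s ∘ σ) id).det =
        ((Equiv.Perm.sign σ : ℤ) : ℂ) * (B.submatrix s id).det := by
      rw [← Matrix.det_permute σ]; rfl
    have hs : (Equiv.arrowCongr σ.symm (Equiv.refl m)) s = s ∘ σ := rfl
    rw [hs, hd]
    simp only [Function.comp_apply]
    ring
  calc ((Fintype.card k).factorial : ℂ) * (A * B).det
      = ∑ σ : Equiv.Perm k, (A * B).det := by
        rw [Finset.sum_const, Finset.card_univ, Fintype.card_perm, nsmul_eq_mul]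
    _ = _ := by
        rw [Finset.sum_congr rfl fun σ _ => h2 σ, Finset.sum_comm]
        refine Finset.sum_congr rfl fun s _ => ?_
        rw [← Finset.sum_mul]
        congr 1
        rw [← Matrix.det_transpose (A.submatrix id s), Matrix.det_apply']
        simp only [Matrix.transpose_apply, Matrix.submatrix_apply, id_eq]

universe u
variable {H : Type u} [NormedAddCommGroup H] [InnerProductSpace ℂ H] {k : ℕ}

/-- The algebraic `k`-th exterior power of a complex inner product space. -/
def AlgPower (k : ℕ) (H : Type u) [NormedAddCommGroup H] [InnerProductSpace ℂ H] : Type u :=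
  ⋀[ℂ]^k H

instance : AddCommGroup (AlgPower k H) := inferInstanceAs (AddCommGroup (⋀[ℂ]^k H))
instance : Module ℂ (AlgPower k H) := inferInstanceAs (Module ℂ (⋀[ℂ]^k H))

/-- The decomposable vector `x 0 ∧ ⋯ ∧ x (k - 1)`. -/
def wedge (x : Fin k → H) : AlgPower k H := exteriorPower.ιMulti ℂ k x

theorem wedge_induction {p : AlgPower k H → Prop} (hw : ∀ x, p (wedge x)) (h0 : p 0)
    (ha : ∀ v w, p v → p w → p (v + w)) (hs : ∀ (c : ℂ) v, p v → p (c • v))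
    (v : AlgPower k H) : p v := by
  have hv : v ∈ Submodule.span ℂ (Set.range (exteriorPower.ιMulti ℂ k (M := H))) := by
    rw [exteriorPower.ιMulti_span]; trivial
  induction hv using Submodule.span_induction with
  | mem x h => obtain ⟨y, rfl⟩ := h; exact hw y
  | zero => exact h0
  | add x y _ _ hx hy => exact ha x y hx hy
  | smul c x _ hx => exact hs c x hx

/-- The linear form `x₁ ∧ ⋯ ∧ xₖ ↦ det ⟪yᵢ, xⱼ⟫`. -/
def gramLeft (y : Fin k → H) : AlgPower k H →ₗ[ℂ] ℂ :=
  exteriorPower.alternatingMapLinearEquiv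
    (detRowAlternating.compLinearMap (LinearMap.pi fun i => (innerSL ℂ (y i)).toLinearMap))

theorem gramLeft_wedge (y x : Fin k → H) :
    gramLeft y (wedge x) = (Matrix.of fun i j => inner ℂ (y i) (x j)).det := by
  rw [← Matrix.det_transpose]
  exact exteriorPower.alternatingMapLinearEquiv_apply_ιMulti _ _

theorem conj_gramLeft_wedge (y x : Fin k → H) :
    (starRingEnd ℂ) (gramLeft y (wedge x)) = gramLeft x (wedge y) := by
  rw [gramLeft_wedge, gramLeft_wedge, ← Matrix.det_transpose]
  rw [RingHom.map_det]
  congr 1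
  ext i j
  simp

/-- For `v` in the exterior power, the alternating map `y ↦ conj ⟪y₁ ∧ ⋯ ∧ yₖ, v⟫`. -/
def gramAlt (v : AlgPower k H) : H [⋀^Fin k]→ₗ[ℂ] ℂ where
  toFun y := (starRingEnd ℂ) (gramLeft y v)
  map_update_add' y i a b := by
    rename_i inst
    obtain rfl : inst = instDecidableEqFin k := Subsingleton.elim _ _
    refine wedge_induction (p := fun v => (starRingEnd ℂ) (gramLeft (Function.update y i (a + b)) v)
      = (starRingEnd ℂ) (gramLeft (Function.update y i a) v) +
        (starRingEnd ℂ) (gramLeft (Function.update y i b) v)) ?_ ?_ ?_ ?_ v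
    · intro x
      simp only [conj_gramLeft_wedge]
      rw [← map_add]
      congr 1
      exact (exteriorPower.ιMulti ℂ k (M := H)).map_update_add y i a b
    · simp
    · intro v w hv hw; simp only [map_add, hv, hw]; ring
    · intro c v hv; simp only [map_smul, smul_eq_mul, map_mul, hv]; ring
  map_update_smul' y i c a := by
    rename_i inst
    obtain rfl : inst = instDecidableEqFin k := Subsingleton.elim _ _
    refine wedge_induction (p := fun v => (starRingEnd ℂ) (gramLeft (Function.update y i (c • a)) v)
      = c • (starRingEnd ℂ) (gramLeft (Function.update y i a) v)) ?_ ?_ ?_ ?_ v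
    · intro x
      simp only [conj_gramLeft_wedge]
      rw [← map_smul]
      congr 1
      exact (exteriorPower.ιMulti ℂ k (M := H)).map_update_smul y i c a
    · simp
    · intro v w hv hw; simp only [map_add, hv, hw, smul_add]
    · intro d v hv; simp only [map_smul, smul_eq_mul, map_mul, hv]; ring
  map_eq_zero_of_eq' y i j hij hne := by
    refine wedge_induction (p := fun v => (starRingEnd ℂ) (gramLeft y v) = 0) ?_ ?_ ?_ ?_ v
    · intro x
      rw [conj_gramLeft_wedge]
      have : wedge y = 0 := (exteriorPower.ιMulti ℂ k (M := H)).map_eq_zero_of_eq y hij hne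
      rw [this, map_zero]
    · simp
    · intro v w hv hw; simp only [map_add, hv, hw, add_zero]
    · intro d v hv; simp only [map_smul, smul_eq_mul, map_mul, hv, mul_zero]

/-- The sesquilinear form with `⟪y₁ ∧ ⋯ ∧ yₖ, x₁ ∧ ⋯ ∧ xₖ⟫ = det ⟪yᵢ, xⱼ⟫`,
conjugate-linear in the first argument. -/
def gramForm (v w : AlgPower k H) : ℂ :=
  (starRingEnd ℂ) (exteriorPower.alternatingMapLinearEquiv (gramAlt w) v)

theorem gramForm_wedge_left (y : Fin k → H) (v : AlgPower k H) :
    gramForm (wedge y) v = gramLeft y v := by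
  have : exteriorPower.alternatingMapLinearEquiv (gramAlt v) (wedge y) = gramAlt v y :=
    exteriorPower.alternatingMapLinearEquiv_apply_ιMulti _ _
  rw [gramForm, this]
  exact Complex.conj_conj _

theorem gramForm_add_left (v v' w : AlgPower k H) :
    gramForm (v + v') w = gramForm v w + gramForm v' w := by
  unfold gramForm
  rw [← map_add]; congr 1
  exact map_add _ _ _

theorem gramForm_smul_left (c : ℂ) (v w : AlgPower k H) :
    gramForm (c • v) w = (starRingEnd ℂ) c * gramForm v w := by
  unfold gramForm
  rw [← map_mul]; congr 1
  exact map_smul _ _ _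

theorem gramForm_zero_left (w : AlgPower k H) : gramForm 0 w = 0 := by
  have := gramForm_smul_left 0 (0 : AlgPower k H) w
  simpa using this

theorem gramForm_add_right (v w w' : AlgPower k H) :
    gramForm v (w + w') = gramForm v w + gramForm v w' := by
  refine wedge_induction (p := fun v => gramForm v (w + w') = gramForm v w + gramForm v w')
    ?_ ?_ ?_ ?_ v
  · intro x; simp only [gramForm_wedge_left, map_add]
  · simp only [gramForm_zero_left, add_zero]
  · intro a b ha hb; simp only [gramForm_add_left, ha, hb]; ring
  · intro c a ha; simp only [gramForm_smul_left, ha]; ring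

theorem gramForm_smul_right (c : ℂ) (v w : AlgPower k H) :
    gramForm v (c • w) = c * gramForm v w := by
  refine wedge_induction (p := fun v => gramForm v (c • w) = c * gramForm v w) ?_ ?_ ?_ ?_ v
  · intro x; simp only [gramForm_wedge_left, map_smul, smul_eq_mul]
  · simp only [gramForm_zero_left, mul_zero]
  · intro a b ha hb; simp only [gramForm_add_left, ha, hb]; ring
  · intro d a ha; simp only [gramForm_smul_left, ha]; ring

theorem gramForm_zero_right (v : AlgPower k H) : gramForm v 0 = 0 := by
  have := gramForm_smul_right 0 v (0 : AlgPower k H)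
  simpa using this

theorem gramForm_conj_symm (v w : AlgPower k H) :
    (starRingEnd ℂ) (gramForm w v) = gramForm v w := by
  refine wedge_induction (p := fun v => (starRingEnd ℂ) (gramForm w v) = gramForm v w)
    ?_ ?_ ?_ ?_ v
  · intro x
    refine wedge_induction (p := fun w => (starRingEnd ℂ) (gramForm w (wedge x)) =
      gramForm (wedge x) w) ?_ ?_ ?_ ?_ w
    · intro y; simp only [gramForm_wedge_left, conj_gramLeft_wedge]
    · simp only [gramForm_zero_left, gramForm_zero_right, map_zero]
    · intro a b ha hb; simp only [gramForm_add_left, gramForm_add_right, map_add, ha, hb]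
    · intro c a ha
      simp only [gramForm_smul_left, gramForm_smul_right, map_mul, ha, Complex.conj_conj]
  · simp only [gramForm_zero_left, gramForm_zero_right, map_zero]
  · intro a b ha hb; simp only [gramForm_add_left, gramForm_add_right, map_add, ha, hb]
  · intro c a ha; simp only [gramForm_smul_left, gramForm_smul_right, map_mul, ha]

theorem gramForm_self_nonneg (v : AlgPower k H) : 0 ≤ (gramForm v v).re := by
  classical
  have hv : v ∈ Submodule.span ℂ (Set.range (exteriorPower.ιMulti ℂ k (M := H))) := by
    rw [exteriorPower.ιMulti_span]; trivial
  obtain ⟨c, hc⟩ := (Finsupp.mem_span_range_iff_exists_finsupp (R := ℂ) (M := ⋀[ℂ]^k H)).1 hv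
  have hc' : v = ∑ x ∈ c.support, c x • wedge x := hc.symm
  let F : Submodule ℂ H := Submodule.span ℂ (⋃ x ∈ c.support, Set.range x)
  have hfin : (⋃ x ∈ c.support, Set.range x : Set H).Finite :=
    c.support.finite_toSet.biUnion fun x _ => Set.finite_range x
  have : FiniteDimensional ℂ F := FiniteDimensional.span_of_finite ℂ hfin
  let e := stdOrthonormalBasis ℂ F
  have hmem : ∀ x ∈ c.support, ∀ i, x i ∈ F := fun x hx i =>
    Submodule.subset_span (Set.mem_biUnion hx (Set.mem_range_self i))
  let D : (Fin k → Fin (Module.finrank ℂ F)) → (Fin k → H) → ℂ := fun s x =>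
    (Matrix.of fun a j => inner ℂ (e (s a) : H) (x j)).det
  have hgram : ∀ x ∈ c.support, ∀ y ∈ c.support,
      (k.factorial : ℂ) * gramForm (wedge x) (wedge y) =
        ∑ s, (starRingEnd ℂ) (D s x) * D s y := by
    intro x hx y hy
    have hm : (Matrix.of fun i j => inner ℂ (x i) (y j)) =
        (Matrix.of fun i m => inner ℂ (x i) (e m : H)) *
          (Matrix.of fun m j => inner ℂ (e m : H) (y j)) := by
      ext i j
      have := e.sum_inner_mul_inner ⟨x i, hmem x hx i⟩ ⟨y j, hmem y hy j⟩
      simpa [Matrix.mul_apply] using this.symm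
    rw [gramForm_wedge_left, gramLeft_wedge, hm]
    have := card_factorial_mul_det_mul (Matrix.of fun i m => inner ℂ (x i) (e m : H))
          (Matrix.of fun m j => inner ℂ (e m : H) (y j))
    rw [Fintype.card_fin] at this
    rw [this]
    refine Finset.sum_congr rfl fun s _ => ?_
    congr 1
    rw [← Matrix.det_transpose, RingHom.map_det]
    congr 1
    ext i j
    simp
  have hsum : (k.factorial : ℂ) * gramForm v v =
      ∑ s, (starRingEnd ℂ) (∑ x ∈ c.support, c x * D s x) * ∑ y ∈ c.support, c y * D s y := by
    have hl : ∀ w, gramForm v w = ∑ x ∈ c.support, (starRingEnd ℂ) (c x) * gramForm (wedge x) w := by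
      intro w
      let L : AlgPower k H →+ ℂ :=
        ⟨⟨fun v => gramForm v w, gramForm_zero_left w⟩, fun a b => gramForm_add_left a b w⟩
      have : L v = _ := congrArg L hc'
      rw [map_sum] at this
      exact this.trans (Finset.sum_congr rfl fun x _ => gramForm_smul_left _ _ _)
    have hr : ∀ w, gramForm w v = ∑ x ∈ c.support, c x * gramForm w (wedge x) := by
      intro w
      let L : AlgPower k H →+ ℂ :=
        ⟨⟨fun v => gramForm w v, gramForm_zero_right w⟩, fun a b => gramForm_add_right w a b⟩
      have : L v = _ := congrArg L hc'
      rw [map_sum] at this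
      exact this.trans (Finset.sum_congr rfl fun x _ => gramForm_smul_right _ _ _)
    calc (k.factorial : ℂ) * gramForm v v
        = ∑ x ∈ c.support, ∑ y ∈ c.support, (starRingEnd ℂ) (c x) * (c y *
            ((k.factorial : ℂ) * gramForm (wedge x) (wedge y))) := by
          rw [hl, Finset.mul_sum]
          refine Finset.sum_congr rfl fun x _ => ?_
          rw [hr, Finset.mul_sum, Finset.mul_sum]
          refine Finset.sum_congr rfl fun y _ => ?_
          ring
      _ = ∑ x ∈ c.support, ∑ y ∈ c.support, ∑ s, (starRingEnd ℂ) (c x * D s x) *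
            (c y * D s y) := by
          refine Finset.sum_congr rfl fun x hx => Finset.sum_congr rfl fun y hy => ?_
          rw [hgram x hx y hy, Finset.mul_sum, Finset.mul_sum]
          refine Finset.sum_congr rfl fun s _ => ?_
          rw [map_mul]; ring
      _ = _ := by
          rw [Finset.sum_congr rfl fun x _ => Finset.sum_comm, Finset.sum_comm]
          refine Finset.sum_congr rfl fun s _ => ?_
          rw [map_sum, Finset.sum_mul_sum]
  have hre : 0 ≤ ((k.factorial : ℂ) * gramForm v v).re := by
    rw [hsum, Complex.re_sum]
    refine Finset.sum_nonneg fun s _ => ?_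
    rw [← Complex.normSq_eq_conj_mul_self, Complex.ofReal_re]
    exact Complex.normSq_nonneg _
  rw [← Complex.ofReal_natCast, Complex.re_ofReal_mul] at hre
  exact nonneg_of_mul_nonneg_right hre (by exact_mod_cast k.factorial_pos)

/-- The (semi-)inner product on the algebraic exterior power given by Gram determinants. -/
instance algPowerCore : PreInnerProductSpace.Core ℂ (AlgPower k H) where
  inner := gramForm
  conj_inner_symm := gramForm_conj_symm
  re_inner_nonneg := gramForm_self_nonneg
  add_left := gramForm_add_left
  smul_left v w c := gramForm_smul_left c v w

instance : SeminormedAddCommGroup (AlgPower k H) :=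
  InnerProductSpace.Core.toSeminormedAddCommGroup (𝕜 := ℂ)

instance : InnerProductSpace ℂ (AlgPower k H) := InnerProductSpace.ofCore algPowerCore

theorem inner_wedge_wedge (x y : Fin k → H) :
    inner ℂ (wedge x) (wedge y) = (Matrix.of fun i j => inner ℂ (x i) (y j)).det :=
  (gramForm_wedge_left x (wedge y)).trans (gramLeft_wedge x y)

/-- The map `x₁ ∧ ⋯ ∧ xₖ ↦ T x₁ ∧ ⋯ ∧ T xₖ` on the algebraic exterior power. -/
def algMap (k : ℕ) (T : H →L[ℂ] H) : AlgPower k H →ₗ[ℂ] AlgPower k H :=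
  exteriorPower.map k T.toLinearMap

theorem algMap_wedge (T : H →L[ℂ] H) (x : Fin k → H) :
    algMap k T (wedge x) = wedge (T ∘ x) :=
  exteriorPower.map_apply_ιMulti _ _

theorem algMap_mul (S T : H →L[ℂ] H) (v : AlgPower k H) :
    algMap k (S * T) v = algMap k S (algMap k T v) :=
  LinearMap.congr_fun (exteriorPower.map_comp T.toLinearMap S.toLinearMap) v

theorem exists_norm_algMap_le (v : AlgPower k H) :
    ∃ K : ℝ, 0 ≤ K ∧ ∀ S : H →L[ℂ] H, ‖algMap k S v‖ ≤ K * ‖S‖ ^ k := by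
  refine wedge_induction (p := fun v => ∃ K : ℝ, 0 ≤ K ∧ ∀ S : H →L[ℂ] H,
    ‖algMap k S v‖ ≤ K * ‖S‖ ^ k) ?_ ?_ ?_ ?_ v
  · intro x
    obtain ⟨R, hR⟩ : ∃ R : ℝ, ∀ i, ‖x i‖ ≤ R :=
      ⟨∑ i, ‖x i‖, fun i => Finset.single_le_sum (f := fun i => ‖x i‖)
        (fun j _ => norm_nonneg _) (Finset.mem_univ i)⟩
    obtain ⟨R, hR, hR0⟩ : ∃ R : ℝ, (∀ i, ‖x i‖ ≤ R) ∧ 0 ≤ R :=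
      ⟨max R 0, fun i => (hR i).trans (le_max_left _ _), le_max_right _ _⟩
    refine ⟨√(k.factorial) * R ^ k, by positivity, fun S => ?_⟩
    refine abs_le_of_sq_le_sq' ?_ (by positivity) |>.2
    rw [algMap_wedge, norm_sq_eq_re_inner (𝕜 := ℂ), inner_wedge_wedge]
    refine (RCLike.re_le_norm _).trans ?_
    have hd := Matrix.det_le (abv := NormedField.toAbsoluteValue ℂ) (x := (‖S‖ * R) ^ 2)
      (A := Matrix.of fun i j => inner ℂ ((S ∘ x) i) ((S ∘ x) j)) (fun i j => by
        have hi : ∀ i, ‖S (x i)‖ ≤ ‖S‖ * R := fun i =>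
          (S.le_opNorm _).trans (mul_le_mul_of_nonneg_left (hR i) (norm_nonneg _))
        have : ‖inner ℂ (S (x i)) (S (x j))‖ ≤ (‖S‖ * R) ^ 2 :=
          (norm_inner_le_norm _ _).trans (by
            rw [sq]; exact mul_le_mul (hi i) (hi j) (norm_nonneg _) (by positivity))
        exact this)
    rw [Fintype.card_fin, nsmul_eq_mul] at hd
    refine le_trans hd (le_of_eq ?_)
    rw [mul_pow (√_ * _), mul_pow (√_), Real.sq_sqrt (by positivity)]
    ring
  · exact ⟨0, le_rfl, fun S => by simp⟩
  · rintro a b ⟨K, hK, ha⟩ ⟨L, hL, hb⟩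
    refine ⟨K + L, by positivity, fun S => ?_⟩
    rw [map_add, add_mul]
    exact (norm_add_le _ _).trans (add_le_add (ha S) (hb S))
  · rintro c a ⟨K, hK, ha⟩
    refine ⟨‖c‖ * K, by positivity, fun S => ?_⟩
    rw [map_smul, norm_smul, mul_assoc]
    exact mul_le_mul_of_nonneg_left (ha S) (norm_nonneg _)

variable [CompleteSpace H]

theorem inner_algMap_left (T : H →L[ℂ] H) (v w : AlgPower k H) :
    inner ℂ (algMap k T v) w = inner ℂ v (algMap k (star T) w) := by
  refine wedge_induction (p := fun v => inner ℂ (algMap k T v) w =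
    inner ℂ v (algMap k (star T) w)) ?_ ?_ ?_ ?_ v
  · intro x
    refine wedge_induction (p := fun w => inner ℂ (algMap k T (wedge x)) w =
      inner ℂ (wedge x) (algMap k (star T) w)) ?_ ?_ ?_ ?_ w
    · intro y
      simp only [algMap_wedge, inner_wedge_wedge]
      congr 1
      ext i j
      simp [ContinuousLinearMap.star_eq_adjoint, ContinuousLinearMap.adjoint_inner_right]
    · simp
    · intro a b ha hb; simp only [map_add, inner_add_right, ha, hb]
    · intro c a ha; simp only [map_smul, inner_smul_right, ha]
  · simp
  · intro a b ha hb; simp only [map_add, inner_add_left, ha, hb]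
  · intro c a ha; simp only [map_smul, inner_smul_left, ha]

theorem norm_algMap_sq_le (T : H →L[ℂ] H) (v : AlgPower k H) :
    ‖algMap k T v‖ ^ 2 ≤ ‖v‖ * ‖algMap k (star T * T) v‖ := by
  rw [norm_sq_eq_re_inner (𝕜 := ℂ), inner_algMap_left, ← algMap_mul]
  exact (RCLike.re_le_norm _).trans (norm_inner_le_norm _ _)

theorem norm_algMap_le_of_isSelfAdjoint {P : H →L[ℂ] H} (hP : IsSelfAdjoint P)
    (v : AlgPower k H) (hv : 0 < ‖v‖) : ‖algMap k P v‖ ≤ ‖P‖ ^ k * ‖v‖ := by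
  obtain ⟨K, hK, hbd⟩ := exists_norm_algMap_le v
  have h1 : ∀ n : ℕ, ‖algMap k P v‖ ^ 2 ^ n * ‖v‖ ≤
      ‖v‖ ^ 2 ^ n * ‖algMap k (P ^ 2 ^ n) v‖ := by
    intro n
    induction n with
    | zero => simp [mul_comm]
    | succ n ih =>
      have hsq := norm_algMap_sq_le (P ^ 2 ^ n) v
      rw [(hP.pow (2 ^ n)).star_eq, ← pow_add, ← two_mul, ← pow_succ'] at hsq
      have h2 := pow_le_pow_left₀ (by positivity) ih 2
      have h3 : (‖algMap k P v‖ ^ 2 ^ (n + 1) * ‖v‖) * ‖v‖ ≤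
          (‖v‖ ^ 2 ^ (n + 1) * ‖algMap k (P ^ 2 ^ (n + 1)) v‖) * ‖v‖ := by
        calc (‖algMap k P v‖ ^ 2 ^ (n + 1) * ‖v‖) * ‖v‖
            = (‖algMap k P v‖ ^ 2 ^ n * ‖v‖) ^ 2 := by rw [pow_succ 2 n, pow_mul]; ring
          _ ≤ (‖v‖ ^ 2 ^ n * ‖algMap k (P ^ 2 ^ n) v‖) ^ 2 := h2
          _ = ‖v‖ ^ 2 ^ (n + 1) * ‖algMap k (P ^ 2 ^ n) v‖ ^ 2 := by
              rw [pow_succ 2 n, pow_mul]; ring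
          _ ≤ ‖v‖ ^ 2 ^ (n + 1) * (‖v‖ * ‖algMap k (P ^ 2 ^ (n + 1)) v‖) := by gcongr
          _ = _ := by ring
      exact le_of_mul_le_mul_right h3 hv
  by_contra! hlt
  set b := ‖P‖ ^ k * ‖v‖ with hb
  have hb0 : 0 ≤ b := by positivity
  have h4 : ∀ n : ℕ, ‖algMap k P v‖ ^ 2 ^ n * ‖v‖ ≤ K * b ^ 2 ^ n := by
    intro n
    refine (h1 n).trans ?_
    have hpow : ‖P ^ 2 ^ n‖ ≤ ‖P‖ ^ 2 ^ n := norm_pow_le' P (by positivity)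
    calc ‖v‖ ^ 2 ^ n * ‖algMap k (P ^ 2 ^ n) v‖
        ≤ ‖v‖ ^ 2 ^ n * (K * (‖P‖ ^ 2 ^ n) ^ k) := by
          refine mul_le_mul_of_nonneg_left ((hbd _).trans ?_) (by positivity)
          gcongr
      _ = K * b ^ 2 ^ n := by rw [hb, mul_pow, ← pow_mul, ← pow_mul, mul_comm k]; ring
  have ha : 0 < ‖algMap k P v‖ := hb0.trans_lt hlt
  rcases hb0.eq_or_lt with hz | hz
  · have := h4 0
    rw [← hz] at this
    simp only [pow_zero, pow_one, mul_zero] at this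
    exact absurd this (not_le.2 (mul_pos ha hv))
  · have hr : 1 < ‖algMap k P v‖ / b := (one_lt_div hz).2 hlt
    obtain ⟨n, hn⟩ := pow_unbounded_of_one_lt (K / ‖v‖) hr
    have hn2 : K / ‖v‖ < (‖algMap k P v‖ / b) ^ 2 ^ n :=
      hn.trans_le (pow_le_pow_right₀ hr.le n.lt_two_pow_self.le)
    rw [div_pow, div_lt_div_iff₀ hv (by positivity)] at hn2
    exact absurd (h4 n) (not_le.2 hn2)

theorem norm_algMap_le (T : H →L[ℂ] H) (v : AlgPower k H) :
    ‖algMap k T v‖ ≤ ‖T‖ ^ k * ‖v‖ := by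
  have hsq := norm_algMap_sq_le T v
  rcases (norm_nonneg v).eq_or_lt with hz | hz
  · rw [← hz, zero_mul] at hsq
    rw [← hz, mul_zero]
    exact (pow_eq_zero_iff two_ne_zero |>.1 (le_antisymm hsq (by positivity))).le
  · have h := norm_algMap_le_of_isSelfAdjoint (IsSelfAdjoint.star_mul_self T) v hz
    rw [CStarRing.norm_star_mul_self] at h
    refine abs_le_of_sq_le_sq' ?_ (by positivity) |>.2
    calc ‖algMap k T v‖ ^ 2 ≤ ‖v‖ * ((‖T‖ * ‖T‖) ^ k * ‖v‖) :=
          hsq.trans (mul_le_mul_of_nonneg_left h (norm_nonneg _))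
      _ = _ := by rw [mul_pow, mul_pow]; ring

/-- The Hilbert space `⋀ᵏ H`: the completion of the algebraic exterior power with respect to the
inner product `⟪y₁ ∧ ⋯ ∧ yₖ, x₁ ∧ ⋯ ∧ xₖ⟫ = det ⟪yᵢ, xⱼ⟫`. -/
abbrev Power (k : ℕ) (H : Type u) [NormedAddCommGroup H] [InnerProductSpace ℂ H] : Type u :=
  UniformSpace.Completion (AlgPower k H)

/-- The bounded operator `⋀ᵏ T` on `⋀ᵏ H`, the continuous extension of
`x₁ ∧ ⋯ ∧ xₖ ↦ T x₁ ∧ ⋯ ∧ T xₖ`. -/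
def powerMap (k : ℕ) (T : H →L[ℂ] H) : Power k H →L[ℂ] Power k H :=
  ((algMap k T).mkContinuous (‖T‖ ^ k) (norm_algMap_le T)).completion

end HilbertExterior

/-! ### Trace class operators and the Fredholm determinant -/

namespace TraceClass

universe u
variable {H : Type u} [NormedAddCommGroup H] [InnerProductSpace ℂ H] [CompleteSpace H]

/-- `T` is of trace class: with `|T| = (T* T)^{1/2}`, the series `∑ ⟪bᵢ, |T| bᵢ⟫` of nonnegative
numbers converges for every orthonormal basis `b` of the Hilbert space. -/
def IsTraceClass (T : H →L[ℂ] H) : Prop :=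
  ∀ (ι : Type u) (b : HilbertBasis ι ℂ H),
    Summable fun i => (inner ℂ (b i) (CFC.abs T (b i))).re

/-- The trace `∑ ⟪bᵢ, T bᵢ⟫` of a trace class operator `T`, where `b` is some orthonormal basis
of the Hilbert space. For a trace class operator the series converges absolutely, and its sum does
not depend on the basis. -/
def trace (T : H →L[ℂ] H) : ℂ :=
  ∑' i, inner ℂ ((exists_hilbertBasis ℂ H).choose_spec.choose i)
    (T ((exists_hilbertBasis ℂ H).choose_spec.choose i))

/-- The Fredholm determinant `det(1 - T) = ∑ₖ (-1)ᵏ tr(⋀ᵏ T)` exists and equals `d`: all the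
operators `⋀ᵏ T` are of trace class, and the series converges absolutely with sum `d`. -/
def HasFredholmDet (T : H →L[ℂ] H) (d : ℂ) : Prop :=
  (∀ k : ℕ, IsTraceClass (HilbertExterior.powerMap k T)) ∧
    HasSum (fun k : ℕ => (-1 : ℂ) ^ k * trace (HilbertExterior.powerMap k T)) d

end TraceClass

/-! ### Cycles in a weighted graph -/

namespace WeightedGraph

universe u
variable {V : Type u} (X : SimpleGraph V)

/-- The graph `X` has bounded valency. -/
def BoundedValency : Prop := ∃ M : ℕ, ∀ x : V, (X.neighborSet x).encard ≤ M

/-- A closed path `(x₀, x₁, …, xₙ)` with `xₙ = x₀` and `n ≥ 1` in the graph `X`, recorded as the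
`n`-periodic sequence `x₀, x₁, …, xₙ = x₀, xₙ₊₁ = x₁, …` that it determines. -/
@[ext]
structure ClosedPath where
  length : ℕ
  length_pos : 0 < length
  vert : ℕ → V
  periodic : ∀ i, vert (i + length) = vert i
  adj : ∀ i, X.Adj (vert i) (vert (i + 1))

variable {X}

namespace ClosedPath

/-- The shifted path `τ(p) = (x₁, x₂, …, xₙ, x₁)`. -/
def shift (p : ClosedPath X) : ClosedPath X where
  length := p.length
  length_pos := p.length_pos
  vert i := p.vert (i + 1)
  periodic i := by rw [add_right_comm]; exact p.periodic (i + 1)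
  adj i := p.adj (i + 1)

/-- The path `(x₀, …, xₙ)` has no backtracking: `x_{j-1} ≠ x_{j+1}` for `1 ≤ j ≤ n - 1`. -/
def IsReduced (p : ClosedPath X) : Prop :=
  ∀ j, 1 ≤ j → j + 1 ≤ p.length → p.vert (j - 1) ≠ p.vert (j + 1)

/-- The `j`-th power of a closed path: run through it `j` times. -/
def pow (p : ClosedPath X) (j : ℕ+) : ClosedPath X where
  length := j * p.length
  length_pos := Nat.mul_pos j.pos p.length_pos
  vert := p.vert
  periodic i := Function.Periodic.nat_mul (f := p.vert) p.periodic j i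
  adj := p.adj

/-- The `i`-th oriented edge `(xᵢ, xᵢ₊₁)` of a closed path. -/
def edge (p : ClosedPath X) (i : ℕ) : X.Dart := ⟨(p.vert i, p.vert (i + 1)), p.adj i⟩

/-- The weight `w(x₀, x₁) ⋯ w(xₙ₋₁, xₙ)` of a closed path. -/
def weight (w : X.Dart → ℝ) (p : ClosedPath X) : ℝ := ∏ i ∈ Finset.range p.length, w (p.edge i)

theorem weight_shift (w : X.Dart → ℝ) (p : ClosedPath X) : p.shift.weight w = p.weight w := by
  have h : p.edge p.length = p.edge 0 := by
    apply SimpleGraph.Dart.ext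
    have h0 := p.periodic 0
    have h1 := p.periodic 1
    rw [zero_add] at h0
    rw [add_comm] at h1
    simp only [edge, h0, h1, zero_add]
  have e : p.shift.weight w = ∏ i ∈ Finset.range p.length, w (p.edge (i + 1)) := rfl
  obtain ⟨n, hn⟩ := Nat.exists_eq_succ_of_ne_zero p.length_pos.ne'
  rw [e, weight, hn, Finset.prod_range_succ, Finset.prod_range_succ', ← h, hn]

end ClosedPath

/-- The equivalence relation on closed paths generated by `p ∼ τ(p)`. -/
def shiftSetoid (X : SimpleGraph V) : Setoid (ClosedPath X) :=
  Relation.EqvGen.setoid fun p q => q = p.shift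

/-- Equivalence classes of closed paths. -/
def PathClass (X : SimpleGraph V) : Type u := Quotient (shiftSetoid X)

namespace PathClass

/-- The class of a closed path. -/
def mk (p : ClosedPath X) : PathClass X := Quotient.mk (shiftSetoid X) p

theorem lift_aux {α : Type*} (f : ClosedPath X → α) (hf : ∀ p, f p.shift = f p)
    (p q : ClosedPath X) (h : Relation.EqvGen (fun p q => q = p.shift) p q) : f p = f q := by
  induction h with
  | rel p q h => rw [h, hf]
  | refl p => rfl
  | symm p q _ h => exact h.symm
  | trans p q r _ _ h h' => exact h.trans h'

/-- The length `l(c)` of a class of closed paths. -/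
def length : PathClass X → ℕ :=
  Quotient.lift ClosedPath.length (lift_aux _ fun _ => rfl)

/-- The weight `w(c)` of a class of closed paths. -/
def weight (w : X.Dart → ℝ) : PathClass X → ℝ :=
  Quotient.lift (ClosedPath.weight w) (lift_aux _ (ClosedPath.weight_shift w))

/-- The power `cʲ` of a class of closed paths, for `j ≥ 1`. -/
def pow (c : PathClass X) (j : ℕ+) : PathClass X :=
  Quotient.lift (fun p : ClosedPath X => mk (p.pow j))
    (lift_aux _ fun p =>
      (Quotient.sound (s := shiftSetoid X) (Relation.EqvGen.rel (p.pow j) (p.pow j).shift rfl)).symm)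
    c

/-- A cycle is an equivalence class of closed paths consisting of reduced paths only. -/
def IsCycle (c : PathClass X) : Prop := ∀ p : ClosedPath X, mk p = c → p.IsReduced

/-- A cycle is prime if it is not a power of a shorter cycle. -/
def IsPrimeCycle (c : PathClass X) : Prop :=
  c.IsCycle ∧ ∀ d : PathClass X, d.IsCycle → ∀ j : ℕ+, d.length < c.length → c ≠ d.pow j

end PathClass

/-- The set of prime cycles of `X`. -/
def PrimeCycle (X : SimpleGraph V) : Type u := {c : PathClass X // c.IsPrimeCycle}

/-- The factor `(1 - w(p) u^{l(p)})⁻¹` of the Euler product at the prime cycle `p`. -/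
def eulerFactor (w : X.Dart → ℝ) (u : ℂ) (p : PrimeCycle X) : ℂ :=
  (1 - (p.1.weight w : ℂ) * u ^ p.1.length)⁻¹

/-! ### The edge transfer operator -/

/-- The Hilbert space `ℓ²(OE)` on the set `OE` of oriented edges of `X`. -/
abbrev L2OE (X : SimpleGraph V) : Type u := lp (fun _ : X.Dart => ℂ) 2

open scoped Classical in
/-- The oriented edge `e` as a unit vector of `ℓ²(OE)`. -/
def unitVec (e : X.Dart) : L2OE X := lp.single 2 e (1 : ℂ)

/-- `e'` may follow `e`: the origin of `e'` is the target of `e`, and `e' ≠ e⁻¹`. -/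
def Follows (e e' : X.Dart) : Prop := e'.fst = e.snd ∧ e' ≠ e.symm

/-- The vector `T e = ∑ w(e') e'`, where `e'` runs through the (finitely many, if the valency
is bounded) oriented edges that may follow `e`. -/
def transferVec (w : X.Dart → ℝ) (e : X.Dart) : L2OE X :=
  ∑' e' : {e' : X.Dart // Follows e e'}, (w e' : ℂ) • unitVec (e' : X.Dart)

/-- The bounded operator `T` on `ℓ²(OE)` with `T e = ∑ w(e') e'`, written as the norm convergent
sum over `e` of the rank one operators `f ↦ ⟨e, f⟩ T e`. That it has the prescribed values on the
oriented edges is `transferOp_unitVec`. -/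
def transferOp (w : X.Dart → ℝ) : L2OE X →L[ℂ] L2OE X :=
  ∑' e : X.Dart, InnerProductSpace.rankOne ℂ (transferVec w e) (unitVec e)

theorem norm_unitVec (e : X.Dart) : ‖unitVec e‖ = 1 := by
  classical
  simp [unitVec]

theorem inner_unitVec (e e' : X.Dart) [Decidable (e = e')] :
    inner ℂ (unitVec e) (unitVec e') = if e = e' then (1 : ℂ) else 0 := by
  classical
  have := lp.inner_single_left (𝕜 := ℂ) (G := fun _ : X.Dart => ℂ) e 1 (unitVec e')
  have h2 : inner ℂ (unitVec e) (unitVec e') = inner ℂ (1 : ℂ) ((unitVec e' : X.Dart → ℂ) e) := this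
  rw [h2]
  simp only [unitVec, lp.single_apply, Pi.single_apply]
  split_ifs <;> simp

theorem finite_follows (hX : BoundedValency X) (e : X.Dart) :
    Finite {e' : X.Dart // Follows e e'} := by
  obtain ⟨M, hM⟩ := hX
  have hfin : (X.neighborSet e.snd).Finite :=
    Set.finite_of_encard_le_coe (hM e.snd)
  have := hfin.to_subtype
  refine Finite.of_injective (β := X.neighborSet e.snd)
    (fun e' => ⟨e'.1.snd, by have := e'.1.adj; rw [e'.2.1] at this; exact this⟩) ?_
  intro a b hab
  apply Subtype.ext
  apply SimpleGraph.Dart.ext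
  refine Prod.ext (a.2.1.trans b.2.1.symm) ?_
  exact congrArg Subtype.val hab

theorem norm_transferVec_le {w : X.Dart → ℝ} (hX : BoundedValency X) (hw : ∀ e, 0 < w e)
    (e : X.Dart) :
    ‖transferVec w e‖ ≤ ∑' e' : {e' : X.Dart // Follows e e'}, w e' := by
  have := finite_follows hX e
  have := Fintype.ofFinite {e' : X.Dart // Follows e e'}
  rw [transferVec, tsum_fintype, tsum_fintype]
  refine (norm_sum_le _ _).trans (le_of_eq (Finset.sum_congr rfl fun e' _ => ?_))
  rw [norm_smul, norm_unitVec, mul_one, Complex.norm_real, Real.norm_of_nonneg (hw _).le]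

theorem summable_norm_transferVec {w : X.Dart → ℝ} (hX : BoundedValency X) (hw : ∀ e, 0 < w e)
    (hsum : Summable w) : Summable fun e => ‖transferVec w e‖ := by
  refine Summable.of_nonneg_of_le (fun e => norm_nonneg _) (norm_transferVec_le hX hw) ?_
  obtain ⟨M, hM⟩ := id hX
  have hcard : ∀ e' : X.Dart, Finite {e : X.Dart // Follows e e'} ∧
      Nat.card {e : X.Dart // Follows e e'} ≤ M := by
    intro e'
    have hfin : (X.neighborSet e'.fst).Finite := Set.finite_of_encard_le_coe (hM e'.fst)
    have := hfin.to_subtype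
    let f : {e : X.Dart // Follows e e'} → X.neighborSet e'.fst := fun e =>
      ⟨e.1.fst, by have := e.1.adj; rw [← e.2.1] at this; exact this.symm⟩
    have hf : Function.Injective f := by
      intro a b hab
      apply Subtype.ext
      apply SimpleGraph.Dart.ext
      exact Prod.ext (congrArg Subtype.val hab) (a.2.1.symm.trans b.2.1)
    refine ⟨Finite.of_injective f hf, (Nat.card_le_card_of_injective f hf).trans ?_⟩
    have h := hM e'.fst
    rw [← hfin.cast_ncard_eq] at h
    exact_mod_cast h
  have hs : Summable fun p : (e' : X.Dart) × {e : X.Dart // Follows e e'} => w p.1 := by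
    have (e' : X.Dart) := (hcard e').1
    rw [summable_sigma_of_nonneg fun p => (hw _).le]
    refine ⟨fun e' => Summable.of_finite, ?_⟩
    refine Summable.of_nonneg_of_le (fun e' => tsum_nonneg fun _ => (hw _).le) (fun e' => ?_)
      (hsum.mul_left (M : ℝ))
    change ∑' _ : {e : X.Dart // Follows e e'}, w e' ≤ _
    rw [tsum_const, nsmul_eq_mul]
    exact mul_le_mul_of_nonneg_right (by exact_mod_cast (hcard e').2) (hw _).le
  let φ : ((e : X.Dart) × {e' : X.Dart // Follows e e'}) ≃
      ((e' : X.Dart) × {e : X.Dart // Follows e e'}) :=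
    { toFun := fun p => ⟨p.2.1, p.1, p.2.2⟩
      invFun := fun p => ⟨p.2.1, p.1, p.2.2⟩
      left_inv := fun _ => rfl
      right_inv := fun _ => rfl }
  have hs' := (φ.summable_iff (f := fun p => w p.1)).2 hs
  exact ((summable_sigma_of_nonneg fun p => (hw _).le).1 hs').2

/-- `T e = ∑ w(e') e'` for every oriented edge `e`. -/
theorem transferOp_unitVec {w : X.Dart → ℝ} (hX : BoundedValency X) (hw : ∀ e, 0 < w e)
    (hsum : Summable w) (e : X.Dart) :
    HasSum (fun e' : {e' : X.Dart // Follows e e'} => (w e' : ℂ) • unitVec (e' : X.Dart))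
      (transferOp w (unitVec e)) := by
  classical
  have hs : Summable fun e : X.Dart =>
      InnerProductSpace.rankOne ℂ (transferVec w e) (unitVec e) := by
    refine Summable.of_norm ?_
    simpa [InnerProductSpace.norm_rankOne, norm_unitVec] using summable_norm_transferVec hX hw hsum
  have hval : transferOp w (unitVec e) = transferVec w e := by
    have happ := (ContinuousLinearMap.apply ℂ (L2OE X) (unitVec e)).map_tsum hs
    simp only [ContinuousLinearMap.apply_apply] at happ
    rw [transferOp, happ, tsum_eq_single e]
    · simp [InnerProductSpace.rankOne_apply, norm_unitVec]
    · intro e' he'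
      simp [InnerProductSpace.rankOne_apply, inner_unitVec, he']
  have := finite_follows hX e
  rw [hval]
  exact Summable.of_finite.hasSum

end WeightedGraph
end

/-! The operator is nuclear: T is the sum over edges e of the rank one operators ⟨e, ·⟩ Te, and Σ
‖Te‖ is finite because an edge follows at most M others and the weights are summable. By an infinite
Cauchy–Binet formula the k-th exterior power is again nuclear (`hasSum_powerMap`), with terms (1/k!)
⟨e₁ ∧ ⋯ ∧ eₖ, ·⟩ Te₁ ∧ ⋯ ∧ Teₖ over k-tuples of edges. So it is of trace class, and its trace is
1/k! times the sum of the k×k principal minors over tuples (`trace_powerMap`). These coefficients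
are at most (Σ ‖Te‖)^k √k!/k!, hence D(u) = det(1 - uT) is entire.

For a finite matrix B and small u, det(1 - uB) = exp(-Σ uᵐ tr(Bᵐ)/m), and tr(Bᵐ) is a sum over
closed walks. Applied to the compressions of the edge matrix to finite sets of edges, and passed to
the limit by dominated convergence on both sides, this expresses D(u) through cyclic sequences of
edges (`fredholmDet_eq_exp`). No information on the eigenvalues of T is needed.

A cyclic sequence of m edges contributes only if it comes from a closed path of length m without
backtracking, its ends included, which is exactly the condition for its class to be a cycle. Each
such path is the j-th power of a unique prime path, and a prime cycle P of length l has exactly l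
representatives. The factor l cancels against 1/(jl), leaving Σ_P Σ_j (w(P)uˡ)ʲ/j = -Σ_P log(1 -
w(P)uˡ). Exponentiating gives the Euler product as 1/D(u) (`hasProd_eulerFactor`). Since D is entire
and D(0) ≠ 0, 1/D is the required meromorphic extension; it has no zeros because D has no poles. -/

noncomputable section

/-! ### Nuclear operators -/

namespace TraceClass

universe u
variable {H : Type u} [NormedAddCommGroup H] [InnerProductSpace ℂ H]

/-! ### The modulus of an operator and its polar decomposition -/

section Modulus

variable [CompleteSpace H]

/-- Both squared norms equal ⟨v, S*S v⟩, since |S|² = S*S. -/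
theorem norm_abs_apply (S : H →L[ℂ] H) (v : H) : ‖CFC.abs S v‖ = ‖S v‖ := by
  have h : ∀ A : H →L[ℂ] H, ‖A v‖ ^ 2 = RCLike.re (inner ℂ v ((star A * A) v)) := by
    intro A
    rw [norm_sq_eq_re_inner (𝕜 := ℂ), ContinuousLinearMap.star_eq_adjoint,
      mul_apply_eq_comp, ContinuousLinearMap.adjoint_inner_right]
  have h1 := h (CFC.abs S)
  rw [(IsSelfAdjoint.of_nonneg (CFC.abs_nonneg S)).star_eq, CFC.abs_mul_abs, ← h S] at h1
  exact (sq_eq_sq₀ (norm_nonneg _) (norm_nonneg _)).1 h1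

/-- The modulus of an operator is the product of the operator with a contraction. -/
theorem exists_contraction_mul_eq_abs (S : H →L[ℂ] H) :
    ∃ U : H →L[ℂ] H, (∀ v, ‖U v‖ ≤ ‖v‖) ∧ ∀ v, U (S v) = CFC.abs S v := by
  -- The assignment S v ↦ |S| v preserves norms, so it extends from the range of S to its closure K;
  -- composing with the orthogonal projection onto K keeps it a contraction.
  let K : Submodule ℂ H := S.range.topologicalClosure
  have hK : ∀ v, S v ∈ K := fun v => Submodule.le_topologicalClosure _ ⟨v, rfl⟩
  have : CompleteSpace K := (Submodule.isClosed_topologicalClosure _).completeSpace_coe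
  let e : H →ₗ[ℂ] K := S.toLinearMap.codRestrict K hK
  have hd : DenseRange e := by
    rw [DenseRange, Subtype.dense_iff]
    intro v hv
    have hv' : v ∈ closure (Set.range S) := hv
    convert hv' using 2
    ext z
    simp [e]
  have hn : ∀ v, ‖(CFC.abs S).toLinearMap v‖ ≤ 1 * ‖e v‖ := fun v => by
    rw [one_mul]; exact (norm_abs_apply S v).le
  refine ⟨((CFC.abs S).toLinearMap.extendOfNorm e).comp K.orthogonalProjectionOnto, fun v => ?_,
    fun v => ?_⟩
  · refine (LinearMap.norm_extendOfNorm_apply_le hd 1 hn _).trans ?_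
    rw [one_mul]
    exact K.norm_orthogonalProjectionOnto_apply_le v
  · have h1 : K.orthogonalProjectionOnto (S v) = e v :=
      Submodule.orthogonalProjectionOnto_mem_subspace_eq_self (e v)
    rw [ContinuousLinearMap.comp_apply, h1]
    exact LinearMap.extendOfNorm_eq hd ⟨1, hn⟩ v

end Modulus

/-! ### Diagonals of nuclear operators in an orthonormal basis -/

section Parseval

variable {ι : Type*} (b : HilbertBasis ι ℂ H)

/-- Cauchy–Schwarz on finite partial sums, then Bessel's inequality for x and for y. -/
theorem summable_norm_inner_mul_inner (x y : H) :
    Summable (fun i => ‖inner ℂ (b i) x‖ * ‖inner ℂ y (b i)‖) ∧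
      ∑' i, ‖inner ℂ (b i) x‖ * ‖inner ℂ y (b i)‖ ≤ ‖x‖ * ‖y‖ := by
  have hbd : ∀ s : Finset ι, ∑ i ∈ s, ‖inner ℂ (b i) x‖ * ‖inner ℂ y (b i)‖ ≤ ‖x‖ * ‖y‖ := by
    intro s
    refine abs_le_of_sq_le_sq' ?_ (by positivity) |>.2
    refine (Finset.sum_mul_sq_le_sq_mul_sq s _ _).trans ?_
    rw [mul_pow]
    simp only [norm_inner_symm y]
    exact mul_le_mul (b.orthonormal.sum_inner_products_le x)
      (b.orthonormal.sum_inner_products_le y) (by positivity) (by positivity)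
  have hs := summable_of_sum_le (fun i => by positivity) hbd
  exact ⟨hs, hs.tsum_le_of_sum_le hbd⟩

variable {N : Type*} {x y : N → H}

/-- Absolute convergence of the double series is what permits exchanging the sum over rank one terms
with the sum over the basis. -/
theorem summable_inner_mul_inner_prod (hxy : Summable fun n => ‖x n‖ * ‖y n‖) :
    Summable fun p : N × ι => inner ℂ (b p.2) (x p.1) * inner ℂ (y p.1) (b p.2) := by
  refine Summable.of_norm ?_
  simp only [norm_mul]
  rw [summable_prod_of_nonneg fun p => by positivity]
  exact ⟨fun n => (summable_norm_inner_mul_inner b (x n) (y n)).1,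
    hxy.of_nonneg_of_le (fun n => tsum_nonneg fun i => by positivity)
      fun n => (summable_norm_inner_mul_inner b (x n) (y n)).2⟩

/-- The diagonal of a nuclear operator is summable in every orthonormal basis, and its sum
does not depend on the basis. -/
theorem hasSum_diagonal (hxy : Summable fun n => ‖x n‖ * ‖y n‖) {S : H →L[ℂ] H}
    (hS : ∀ v, HasSum (fun n => inner ℂ (y n) v • x n) (S v)) :
    HasSum (fun i => inner ℂ (b i) (S (b i))) (∑' n, inner ℂ (y n) (x n)) := by
  have hsum := summable_inner_mul_inner_prod b hxy
  have h1 : HasSum (fun p : N × ι => inner ℂ (b p.2) (x p.1) * inner ℂ (y p.1) (b p.2))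
      (∑' n, inner ℂ (y n) (x n)) := by
    have hn : ∀ n, ∑' i, inner ℂ (b i) (x n) * inner ℂ (y n) (b i) = inner ℂ (y n) (x n) :=
      fun n => (tsum_congr fun i => mul_comm _ _).trans (b.tsum_inner_mul_inner (y n) (x n))
    have := hsum.hasSum
    rw [hsum.tsum_prod] at this
    simpa only [hn] using this
  have h2 := ((Equiv.prodComm ι N).hasSum_iff).2 h1
  refine h2.prod_fiberwise fun i => ?_
  simpa [inner_smul_right, mul_comm] using (hS (b i)).mapL (innerSL ℂ (b i))

end Parseval

variable [CompleteSpace H]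

/-- Writing |S| = U S with a contraction U, the modulus is nuclear with vectors U xₙ in place of xₙ,
so its diagonal is summable in every basis. -/
theorem isTraceClass_of_nuclear {N : Type*} {x y : N → H} {S : H →L[ℂ] H}
    (hxy : Summable fun n => ‖x n‖ * ‖y n‖)
    (hS : ∀ v, HasSum (fun n => inner ℂ (y n) v • x n) (S v)) : IsTraceClass S := by
  intro ι b
  obtain ⟨U, hU, hUS⟩ := exists_contraction_mul_eq_abs S
  have hd := hasSum_diagonal b (x := fun n => U (x n)) (y := y) (S := CFC.abs S)
    (hxy.of_nonneg_of_le (fun n => by positivity) fun n =>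
      mul_le_mul_of_nonneg_right (hU _) (norm_nonneg _))
    (fun v => by simpa [hUS] using (hS v).mapL U)
  exact (Complex.hasSum_re hd).summable

theorem trace_of_nuclear {N : Type*} {x y : N → H} {S : H →L[ℂ] H}
    (hxy : Summable fun n => ‖x n‖ * ‖y n‖)
    (hS : ∀ v, HasSum (fun n => inner ℂ (y n) v • x n) (S v)) :
    trace S = ∑' n, inner ℂ (y n) (x n) :=
  (hasSum_diagonal _ hxy hS).tsum_eq

end TraceClass
end

noncomputable section

/-! ### Sums over tuples -/

section Tuples

open Filter Topology

variable {E : Type*} {k : ℕ}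

/-- A finite set of tuples lies in a box Fᵏ, over which the sum of products factors into a k-th
power. -/
theorem summable_prod_tuple {c : E → ℝ} (hc : ∀ e, 0 ≤ c e) (hs : Summable c) :
    Summable (fun s : Fin k → E => ∏ i, c (s i)) ∧
      ∑' s : Fin k → E, ∏ i, c (s i) ≤ (∑' e, c e) ^ k := by
  classical
  have hbd : ∀ A : Finset (Fin k → E), ∑ s ∈ A, ∏ i, c (s i) ≤ (∑' e, c e) ^ k := by
    intro A
    let F : Finset E := A.biUnion fun s => Finset.univ.image s
    have hA : A ⊆ Fintype.piFinset fun _ => F := by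
      intro s hsA
      rw [Fintype.mem_piFinset]
      exact fun i => Finset.mem_biUnion.2 ⟨s, hsA, Finset.mem_image_of_mem _ (Finset.mem_univ i)⟩
    refine (Finset.sum_le_sum_of_subset_of_nonneg hA fun s _ _ =>
      Finset.prod_nonneg fun i _ => hc _).trans ?_
    rw [← Finset.prod_univ_sum (fun _ : Fin k => F) fun _ e => c e, Finset.prod_const,
      Finset.card_univ, Fintype.card_fin]
    exact pow_le_pow_left₀ (Finset.sum_nonneg fun e _ => hc e)
      (hs.sum_le_tsum F fun e _ => hc e) k
  have h := summable_of_sum_le (fun s => Finset.prod_nonneg fun i _ => hc _) hbd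
  exact ⟨h, h.tsum_le_of_sum_le hbd⟩

theorem sum_tuple_subtype (F : Finset E) (g : (Fin k → E) → ℂ) :
    ∑ s : Fin k → F, g (fun i => s i) = ∑ s ∈ Fintype.piFinset fun _ : Fin k => F, g s := by
  refine Finset.sum_bij' (fun s _ i => (s i : E))
    (fun s hs i => ⟨s i, Fintype.mem_piFinset.1 hs i⟩) ?_ ?_ ?_ ?_ ?_ <;> simp

/-- The boxes Fᵏ are cofinal among finite sets of tuples, so unconditional summation may be carried
out along them. -/
theorem tendsto_sum_tuple {g : (Fin k → E) → ℂ} (hg : Summable g) :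
    Tendsto (fun F : Finset E => ∑ s : Fin k → F, g (fun i => s i)) atTop (𝓝 (∑' s, g s)) := by
  classical
  simp only [sum_tuple_subtype]
  refine (show Tendsto _ atTop _ from hg.hasSum).comp
    (tendsto_atTop_finset_of_monotone (fun F G hFG => ?_) fun s => ?_)
  · exact Fintype.piFinset_subset _ _ fun _ => hFG
  · exact ⟨Finset.univ.image s, Fintype.mem_piFinset.2 fun i =>
      Finset.mem_image_of_mem _ (Finset.mem_univ i)⟩

/-- The Cauchy–Binet formula for matrices with infinitely many columns and rows. -/
theorem factorial_mul_det_eq_tsum {a : Fin k → E → ℂ} {b : E → Fin k → ℂ}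
    {c : Matrix (Fin k) (Fin k) ℂ} (hc : ∀ i j, HasSum (fun e => a i e * b e j) (c i j))
    (hs : Summable fun s : Fin k → E => (Matrix.of fun i j => a i (s j)).det *
      (Matrix.of fun i j => b (s i) j).det) :
    (k.factorial : ℂ) * c.det = ∑' s : Fin k → E, (Matrix.of fun i j => a i (s j)).det *
      (Matrix.of fun i j => b (s i) j).det := by
  have h1 := tendsto_sum_tuple hs
  have h2 : Tendsto (fun F : Finset E => (k.factorial : ℂ) *
      (Matrix.of fun i j => ∑ e ∈ F, a i e * b e j).det) atTop (𝓝 (k.factorial * c.det)) := by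
    refine Tendsto.const_mul _ ?_
    have hcont : Continuous fun M : Matrix (Fin k) (Fin k) ℂ => M.det := continuous_id.matrix_det
    refine (hcont.tendsto c).comp ?_
    refine tendsto_pi_nhds.2 fun i => tendsto_pi_nhds.2 fun j => hc i j
  -- For each finite F the finite Cauchy–Binet formula equates the two sides; continuity of the
  -- determinant gives the limit of one, summability that of the other.
  refine tendsto_nhds_unique (h2.congr fun F => ?_) h1
  have := HilbertExterior.card_factorial_mul_det_mul
    (Matrix.of fun (i : Fin k) (e : F) => a i e) (Matrix.of fun (e : F) (j : Fin k) => b e j)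
  rw [Fintype.card_fin] at this
  refine Eq.trans ?_ this
  congr 2
  ext i j
  rw [Matrix.mul_apply]
  exact (Finset.sum_coe_sort F fun e => a i e * b e j).symm

end Tuples

/-! ### Exterior powers of nuclear operators -/

namespace HilbertExterior

universe u
variable {H : Type u} [NormedAddCommGroup H] [InnerProductSpace ℂ H] {k : ℕ}

/-- Each of the k! terms of the Gram determinant is at most the product of the ‖xᵢ‖². Hadamard's
inequality would remove √k!, but the later factor 1/k! absorbs it. -/
theorem norm_wedge_le (x : Fin k → H) : ‖wedge x‖ ≤ √k.factorial * ∏ i, ‖x i‖ := by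
  refine abs_le_of_sq_le_sq' ?_ (by positivity) |>.2
  rw [norm_sq_eq_re_inner (𝕜 := ℂ), inner_wedge_wedge, Matrix.det_apply]
  refine (RCLike.re_le_norm _).trans ((norm_sum_le _ _).trans ?_)
  have hσ : ∀ σ ∈ (Finset.univ : Finset (Equiv.Perm (Fin k))),
      ‖Equiv.Perm.sign σ • ∏ i, (Matrix.of fun i j => inner ℂ (x i) (x j)) (σ i) i‖ ≤
        (∏ i, ‖x i‖) ^ 2 := by
    intro σ _
    have h1 : ‖Equiv.Perm.sign σ • ∏ i, (Matrix.of fun i j => inner ℂ (x i) (x j)) (σ i) i‖ =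
        ∏ i, ‖inner ℂ (x (σ i)) (x i)‖ := by
      rcases Int.units_eq_one_or (Equiv.Perm.sign σ) with h | h <;> simp [h]
    have h2 : (∏ i, ‖x i‖) ^ 2 = ∏ i, ‖x (σ i)‖ * ‖x i‖ := by
      rw [Finset.prod_mul_distrib, Equiv.prod_comp σ fun i => ‖x i‖, sq]
    rw [h1, h2]
    exact Finset.prod_le_prod (fun i _ => norm_nonneg _) fun i _ => norm_inner_le_norm _ _
  refine (Finset.sum_le_card_nsmul _ _ _ hσ).trans (le_of_eq ?_)
  rw [Finset.card_univ, Fintype.card_perm, Fintype.card_fin, nsmul_eq_mul, mul_pow,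
    Real.sq_sqrt (by positivity)]

/-- The Gram matrix is the identity if s is injective and has two equal rows otherwise. -/
theorem norm_wedge_le_one {E : Type*} {y : E → H} (hy : Orthonormal ℂ y) (s : Fin k → E) :
    ‖wedge (y ∘ s)‖ ≤ 1 := by
  classical
  rw [← sq_le_one_iff₀ (norm_nonneg _), norm_sq_eq_re_inner (𝕜 := ℂ), inner_wedge_wedge]
  by_cases h : Function.Injective s
  · have : (Matrix.of fun i j => inner ℂ ((y ∘ s) i) ((y ∘ s) j)) = 1 := by
      ext i j
      simp [orthonormal_iff_ite.1 hy, Matrix.one_apply, h.eq_iff]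
    rw [this]
    simp
  · obtain ⟨i, j, hij, hne⟩ : ∃ i j, s i = s j ∧ i ≠ j := by
      simpa [Function.Injective] using h
    rw [Matrix.det_zero_of_row_eq hne (by ext l; simp [hij])]
    simp

variable {E : Type*} {x y : E → H} {T : H →L[ℂ] H}

theorem norm_inner_mul_inner_wedge_le (z v : Fin k → H) (hy : Orthonormal ℂ y) (s : Fin k → E) :
    ‖inner ℂ (wedge z) (wedge (x ∘ s)) * inner ℂ (wedge (y ∘ s)) (wedge v)‖ ≤
      (‖wedge z‖ * ‖wedge v‖ * √k.factorial) * ∏ i, ‖x (s i)‖ := by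
  rw [norm_mul]
  calc _ ≤ (‖wedge z‖ * ‖wedge (x ∘ s)‖) * (‖wedge (y ∘ s)‖ * ‖wedge v‖) :=
        mul_le_mul (norm_inner_le_norm _ _) (norm_inner_le_norm _ _) (norm_nonneg _)
          (by positivity)
    _ ≤ (‖wedge z‖ * (√k.factorial * ∏ i, ‖x (s i)‖)) * (1 * ‖wedge v‖) := by
        gcongr
        · exact norm_wedge_le (x ∘ s)
        · exact norm_wedge_le_one hy s
    _ = _ := by ring

/-- Cauchy–Binet applied to ⟨zᵢ, T vⱼ⟩ = Σ ⟨zᵢ, xₑ⟩ ⟨yₑ, vⱼ⟩. Tuples count every set of k indices k!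
times, whence the factor 1/k!. -/
theorem inner_wedge_wedge_comp (hx : Summable fun e => ‖x e‖) (hy : Orthonormal ℂ y)
    (hT : ∀ v, HasSum (fun e => inner ℂ (y e) v • x e) (T v)) (z v : Fin k → H) :
    HasSum (fun s : Fin k → E => (k.factorial : ℂ)⁻¹ *
      (inner ℂ (wedge z) (wedge (x ∘ s)) * inner ℂ (wedge (y ∘ s)) (wedge v)))
      (inner ℂ (wedge z) (wedge (T ∘ v))) := by
  have hs : Summable fun s : Fin k → E =>
      inner ℂ (wedge z) (wedge (x ∘ s)) * inner ℂ (wedge (y ∘ s)) (wedge v) :=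
    .of_norm_bounded ((summable_prod_tuple (fun e => norm_nonneg (x e)) hx).1.mul_left _)
      (norm_inner_mul_inner_wedge_le z v hy)
  have hf : (k.factorial : ℂ) ≠ 0 := by exact_mod_cast k.factorial_ne_zero
  have key := factorial_mul_det_eq_tsum (a := fun i e => inner ℂ (z i) (x e))
    (b := fun e j => inner ℂ (y e) (v j)) (c := Matrix.of fun i j => inner ℂ (z i) (T (v j)))
    (fun i j => by
      simpa [inner_smul_right, mul_comm] using (hT (v j)).mapL (innerSL ℂ (z i)))
    (by simpa only [inner_wedge_wedge, Function.comp_apply] using hs)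
  have h2 : inner ℂ (wedge z) (wedge (T ∘ v)) = (k.factorial : ℂ)⁻¹ * ∑' s : Fin k → E,
      inner ℂ (wedge z) (wedge (x ∘ s)) * inner ℂ (wedge (y ∘ s)) (wedge v) := by
    simp only [inner_wedge_wedge, Function.comp_apply]
    rw [eq_inv_mul_iff_mul_eq₀ hf]
    exact key
  rw [h2]
  exact hs.hasSum.mul_left _

theorem summable_norm_wedge (hx : Summable fun e => ‖x e‖) (hy : Orthonormal ℂ y) :
    Summable fun s : Fin k → E => ‖((k.factorial : ℂ)⁻¹ • (wedge (x ∘ s) : Power k H))‖ *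
      ‖(wedge (y ∘ s) : Power k H)‖ := by
  refine ((summable_prod_tuple (k := k) (fun e => norm_nonneg (x e)) hx).1.mul_left
    (‖(k.factorial : ℂ)⁻¹‖ * √k.factorial)).of_nonneg_of_le (fun s => by positivity) fun s => ?_
  rw [norm_smul, UniformSpace.Completion.norm_coe, UniformSpace.Completion.norm_coe]
  calc _ ≤ (‖(k.factorial : ℂ)⁻¹‖ * (√k.factorial * ∏ i, ‖x (s i)‖)) * 1 := by
        gcongr
        · exact norm_wedge_le (x ∘ s)
        · exact norm_wedge_le_one hy s
    _ = _ := by ring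

/-- The principal minors of a nuclear operator are bounded by Hadamard type products. -/
theorem norm_minor_le (hy : Orthonormal ℂ y) {k : ℕ} (s : Fin k → E) :
    ‖(Matrix.of fun i j => inner ℂ (y (s i)) (x (s j))).det‖ ≤
      √k.factorial * ∏ i, ‖x (s i)‖ := by
  have h := inner_wedge_wedge (y ∘ s) (x ∘ s)
  simp only [Function.comp_apply] at h
  rw [← h]
  refine (norm_inner_le_norm _ _).trans ?_
  refine (mul_le_mul (norm_wedge_le_one hy s)
    (norm_wedge_le (x ∘ s)) (norm_nonneg _) zero_le_one).trans ?_
  rw [one_mul]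
  rfl

/-- The exterior power of a nuclear operator is nuclear: the series converges in operator norm to
some R, and R is identified with `powerMap k T` by its matrix coefficients, first between
decomposable vectors, then by linearity and density. -/
theorem hasSum_powerMap [CompleteSpace H] (hx : Summable fun e => ‖x e‖) (hy : Orthonormal ℂ y)
    (hT : ∀ v, HasSum (fun e => inner ℂ (y e) v • x e) (T v)) (v : Power k H) :
    HasSum (fun s : Fin k → E => inner ℂ (wedge (y ∘ s) : Power k H) v •
      ((k.factorial : ℂ)⁻¹ • (wedge (x ∘ s) : Power k H))) (powerMap k T v) := by
  have hs : Summable fun s : Fin k → E => InnerProductSpace.rankOne ℂ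
      ((k.factorial : ℂ)⁻¹ • (wedge (x ∘ s) : Power k H)) (wedge (y ∘ s) : Power k H) := by
    refine Summable.of_norm ?_
    simpa only [InnerProductSpace.norm_rankOne] using summable_norm_wedge hx hy
  set R := ∑' s : Fin k → E, InnerProductSpace.rankOne ℂ
      ((k.factorial : ℂ)⁻¹ • (wedge (x ∘ s) : Power k H)) (wedge (y ∘ s) : Power k H) with hR
  have hRv : ∀ v, HasSum (fun s : Fin k → E => inner ℂ (wedge (y ∘ s) : Power k H) v •
      ((k.factorial : ℂ)⁻¹ • (wedge (x ∘ s) : Power k H))) (R v) := fun v => by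
    simpa only [ContinuousLinearMap.apply_apply, InnerProductSpace.rankOne_apply] using
      hs.hasSum.mapL (ContinuousLinearMap.apply ℂ (Power k H) v)
  suffices h : ∀ z v : Power k H, inner ℂ z (R v) = inner ℂ z (powerMap k T v) by
    rw [← ext_inner_left ℂ fun z => h z v]
    exact hRv v
  have hcoe : ∀ v : AlgPower k H, powerMap k T v = (algMap k T v : Power k H) := fun v =>
    ContinuousLinearMap.completion_apply_coe _ v
  intro z v
  induction z, v using UniformSpace.Completion.induction_on₂ with
  | hp => exact isClosed_eq (by fun_prop) (by fun_prop)
  | ih z v =>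
  rw [hcoe]
  refine wedge_induction (p := fun v : AlgPower k H => inner ℂ (z : Power k H) (R v) =
    inner ℂ (z : Power k H) (algMap k T v : Power k H)) (fun v => ?_) ?_ ?_ ?_ v
  · refine wedge_induction (p := fun z : AlgPower k H => inner ℂ (z : Power k H)
      (R (wedge v : AlgPower k H)) =
      inner ℂ (z : Power k H) (algMap k T (wedge v) : Power k H)) (fun z => ?_) ?_ ?_ ?_ z
    · have h1 := (hRv (wedge v : AlgPower k H)).mapL (innerSL ℂ (wedge z : Power k H))
      refine h1.unique ?_
      rw [algMap_wedge, UniformSpace.Completion.inner_coe]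
      refine HasSum.congr_fun (inner_wedge_wedge_comp hx hy hT z v) fun s => ?_
      simp only [innerSL_apply_apply, inner_smul_right, UniformSpace.Completion.inner_coe]
      ring
    · simp only [UniformSpace.Completion.coe_zero, inner_zero_left]
    · intro a b ha hb
      simp only [UniformSpace.Completion.coe_add, inner_add_left, ha, hb]
    · intro c a ha
      simp only [UniformSpace.Completion.coe_smul, inner_smul_left, ha]
  · simp only [UniformSpace.Completion.coe_zero, map_zero, inner_zero_right]
  · intro a b ha hb
    simp only [UniformSpace.Completion.coe_add, map_add, inner_add_right, ha, hb]
  · intro c a ha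
    simp only [UniformSpace.Completion.coe_smul, map_smul, inner_smul_right, ha]

end HilbertExterior

namespace TraceClass

universe u
variable {H : Type u} [NormedAddCommGroup H] [InnerProductSpace ℂ H] [CompleteSpace H]
  {E : Type*} {x y : E → H} {T : H →L[ℂ] H}

theorem isTraceClass_powerMap (hx : Summable fun e => ‖x e‖) (hy : Orthonormal ℂ y)
    (hT : ∀ v, HasSum (fun e => inner ℂ (y e) v • x e) (T v)) (k : ℕ) :
    IsTraceClass (HilbertExterior.powerMap k T) :=
  isTraceClass_of_nuclear (HilbertExterior.summable_norm_wedge hx hy)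
    (HilbertExterior.hasSum_powerMap hx hy hT)

/-- The trace of an exterior power as a sum of principal minors. -/
theorem trace_powerMap (hx : Summable fun e => ‖x e‖) (hy : Orthonormal ℂ y)
    (hT : ∀ v, HasSum (fun e => inner ℂ (y e) v • x e) (T v)) (k : ℕ) :
    trace (HilbertExterior.powerMap k T) = ∑' s : Fin k → E, (k.factorial : ℂ)⁻¹ *
      (Matrix.of fun i j => inner ℂ (y (s i)) (x (s j))).det := by
  rw [trace_of_nuclear (HilbertExterior.summable_norm_wedge hx hy)
    (HilbertExterior.hasSum_powerMap hx hy hT)]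
  refine tsum_congr fun s => ?_
  rw [inner_smul_right, UniformSpace.Completion.inner_coe, HilbertExterior.inner_wedge_wedge]
  rfl

end TraceClass
end

noncomputable section

/-! ### Determinants, traces of powers, and principal minors -/

namespace Matrix

open Polynomial

variable {n : Type*} [Fintype n] [DecidableEq n]

/-- Tuples with a repetition give two equal rows; the tuples with image S are its k! enumerations,
all with the same minor. -/
theorem sum_det_submatrix_tuple (M : Matrix n n ℂ) (k : ℕ) :
    ∑ s : Fin k → n, (M.submatrix s s).det = k.factorial *
      ∑ S ∈ Finset.univ.powersetCard k,
        (M.submatrix (Subtype.val : S → n) (Subtype.val : S → n)).det := by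
  have h0 : ∑ s : Fin k → n, (M.submatrix s s).det =
      ∑ s : Fin k → n with Function.Injective s, (M.submatrix s s).det := by
    refine (Finset.sum_filter_of_ne fun s _ hs => ?_).symm
    intro i j hij
    by_contra hne
    exact hs (det_zero_of_row_eq hne (by ext l; simp [hij]))
  have hmap : ∀ s ∈ Finset.univ.filter fun s : Fin k → n => Function.Injective s,
      Finset.univ.image s ∈ (Finset.univ : Finset n).powersetCard k := by
    intro s hs
    rw [Finset.mem_powersetCard, Finset.card_image_of_injective _ (Finset.mem_filter.1 hs).2]
    simp
  rw [h0, ← Finset.sum_fiberwise_of_maps_to hmap, Finset.mul_sum]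
  refine Finset.sum_congr rfl fun S hS => ?_
  have hcard : Fintype.card S = k := by simpa using hS
  have hbij : ∑ e : Fin k ≃ S, (M.submatrix (fun i => (e i : n)) (fun i => (e i : n))).det =
      ∑ s ∈ (Finset.univ.filter fun s : Fin k → n => Function.Injective s) with
        Finset.univ.image s = S, (M.submatrix s s).det := by
    refine Finset.sum_bij (fun e _ i => (e i : n)) ?_ ?_ ?_ fun _ _ => rfl
    · intro e _
      simp only [Finset.mem_filter, Finset.mem_univ, true_and]
      refine ⟨Subtype.val_injective.comp e.injective, ?_⟩
      ext a
      simp only [Finset.mem_image, Finset.mem_univ, true_and]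
      constructor
      · rintro ⟨i, rfl⟩; exact (e i).2
      · intro ha; exact ⟨e.symm ⟨a, ha⟩, by simp⟩
    · intro e _ e' _ h
      ext i
      exact congrFun h i
    · intro s hs
      simp only [Finset.mem_filter, Finset.mem_univ, true_and] at hs
      obtain ⟨hinj, rfl⟩ := hs
      let f : Fin k → Finset.univ.image s := fun i =>
        ⟨s i, Finset.mem_image_of_mem _ (Finset.mem_univ i)⟩
      have hf : Function.Bijective f := by
        refine ⟨fun i j hij => hinj (congrArg Subtype.val hij), ?_⟩
        rintro ⟨a, ha⟩
        obtain ⟨i, -, rfl⟩ := Finset.mem_image.1 ha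
        exact ⟨i, rfl⟩
      exact ⟨Equiv.ofBijective f hf, Finset.mem_univ _, rfl⟩
  rw [← hbij]
  have hdet : ∀ e : Fin k ≃ S, (M.submatrix (fun i => (e i : n)) (fun i => (e i : n))).det =
      (M.submatrix (Subtype.val : S → n) (Subtype.val : S → n)).det := fun e =>
    det_submatrix_equiv_self e (M.submatrix (Subtype.val : S → n) (Subtype.val : S → n))
  rw [Finset.sum_congr rfl fun e _ => hdet e, Finset.sum_const, Finset.card_univ,
    Fintype.card_equiv (Fintype.equivOfCardEq (by simp [hcard])), Fintype.card_fin, nsmul_eq_mul]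

/-- The Fredholm expansion of `det (1 + z M)` for a finite matrix. -/
theorem hasSum_det_one_add_smul (M : Matrix n n ℂ) (z : ℂ) :
    HasSum (fun k : ℕ => z ^ k * ((k.factorial : ℂ)⁻¹ * ∑ s : Fin k → n, (M.submatrix s s).det))
      (1 + z • M).det := by
  set p : ℂ[X] := (1 + (X : ℂ[X]) • M.map C).det with hp
  have heval : p.eval z = (1 + z • M).det := by
    rw [hp, ← coe_evalRingHom, RingHom.map_det]
    congr 1
    ext i j
    by_cases h : i = j <;> simp [h] <;> ring
  have hcoeff : ∀ k : ℕ, z ^ k * ((k.factorial : ℂ)⁻¹ *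
      ∑ s : Fin k → n, (M.submatrix s s).det) = p.coeff k * z ^ k := by
    intro k
    rw [hp, coeff_det_one_add_X_smul_eq_sum_minors, sum_det_submatrix_tuple,
      ← mul_assoc _ (k.factorial : ℂ), inv_mul_cancel₀ (by exact_mod_cast k.factorial_ne_zero), one_mul,
      mul_comm]
  simp only [hcoeff]
  rw [← heval, eval_eq_sum_range]
  refine hasSum_sum_of_ne_finset_zero fun k hk => ?_
  rw [coeff_eq_zero_of_natDegree_lt (by simpa using hk), zero_mul]

/-- Both sides are multiplicative in p, so over ℂ it suffices to treat constants and linear factors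
X - r. This one identity yields the eigenvalues of powers and the factorization of det(1 - uA). -/
theorem det_aeval (A : Matrix n n ℂ) (p : ℂ[X]) :
    (aeval A p).det = (A.charpoly.roots.map fun r => p.eval r).prod := by
  have hcard : A.charpoly.roots.card = Fintype.card n := by
    rw [← (IsAlgClosed.splits A.charpoly).natDegree_eq_card_roots, charpoly_natDegree_eq_dim]
  have hlin : ∀ r : ℂ, (aeval A (X - C r)).det =
      (A.charpoly.roots.map fun l => (X - C r : ℂ[X]).eval l).prod := by
    intro r
    have h1 : A.charpoly.eval r = (A.charpoly.roots.map fun l => r - l).prod := by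
      conv_lhs => rw [(IsAlgClosed.splits A.charpoly).eq_prod_roots_of_monic A.charpoly_monic]
      simp [eval_multiset_prod]
    have h2 : aeval A (X - C r) = -(scalar n r - A) := by
      simp [Matrix.algebraMap_eq_diagonal, Matrix.scalar_apply, Pi.algebraMap_def]
    rw [h2, det_neg, ← eval_charpoly, h1, ← hcard]
    have h3 : (A.charpoly.roots.map fun l => (X - C r : ℂ[X]).eval l) =
        A.charpoly.roots.map fun l => (-1) * (r - l) := by
      refine Multiset.map_congr rfl fun l _ => ?_
      simp
    rw [h3, Multiset.prod_map_mul]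
    simp
  have hconst : ∀ c : ℂ, (aeval A (C c)).det =
      (A.charpoly.roots.map fun l => (C c : ℂ[X]).eval l).prod := by
    intro c
    simp [hcard, Algebra.algebraMap_eq_smul_one]
  let φ : ℂ[X] →* ℂ := (detMonoidHom : Matrix n n ℂ →* ℂ).comp (aeval A : ℂ[X] →ₐ[ℂ] _)
  let ψ : ℂ[X] →* ℂ :=
    { toFun := fun p => (A.charpoly.roots.map fun r => p.eval r).prod
      map_one' := by simp
      map_mul' := fun p q => by simp [Multiset.prod_map_mul] }
  change φ p = ψ p
  rw [(IsAlgClosed.splits p).eq_prod_roots, map_mul, map_mul, map_multiset_prod, map_multiset_prod,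
    Multiset.map_map, Multiset.map_map]
  exact congrArg₂ (· * ·) (hconst _)
    (congrArg Multiset.prod (Multiset.map_congr rfl fun r _ => hlin r))

theorem trace_pow_eq_sum_roots (A : Matrix n n ℂ) (m : ℕ) :
    (A ^ m).trace = (A.charpoly.roots.map fun r => r ^ m).sum := by
  have h : (A ^ m).charpoly = ((A.charpoly.roots.map fun r => r ^ m).map fun r => X - C r).prod := by
    -- The value of the characteristic polynomial of Aᵐ at t is the determinant of the polynomial t
    -- - Xᵐ evaluated at A.
    refine Polynomial.funext fun t => ?_
    have h1 : scalar n t - A ^ m = aeval A (C t - X ^ m) := by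
      simp [Matrix.algebraMap_eq_diagonal, Matrix.scalar_apply, Pi.algebraMap_def]
    rw [eval_charpoly, h1, det_aeval]
    simp [eval_multiset_prod]
  rw [trace_eq_sum_roots_charpoly, h, roots_multiset_prod_X_sub_C]

theorem det_one_sub_smul_eq_prod_roots (A : Matrix n n ℂ) (u : ℂ) :
    (1 - u • A).det = (A.charpoly.roots.map fun r => 1 - u * r).prod := by
  have h := det_aeval A (1 - C u * X)
  simpa [Algebra.smul_def] using h

/-- Gershgorin's theorem. The bound depends only on row sums, so it is uniform over compressions of
the edge matrix. -/
theorem norm_root_charpoly_le {A : Matrix n n ℂ} {W : ℝ} (hA : ∀ i, ∑ j, ‖A i j‖ ≤ W) {r : ℂ}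
    (hr : r ∈ A.charpoly.roots) : ‖r‖ ≤ W := by
  have hspec := mem_spectrum_of_isRoot_charpoly (isRoot_of_mem_roots hr)
  have hev : Module.End.HasEigenvalue (Matrix.toLin' A) r := by
    rw [Module.End.hasEigenvalue_iff_mem_spectrum, Matrix.spectrum_toLin']
    exact hspec
  obtain ⟨k, hk⟩ := eigenvalue_mem_ball hev
  rw [Metric.mem_closedBall, dist_eq_norm] at hk
  have h1 : ‖r‖ ≤ ‖A k k‖ + ‖r - A k k‖ := by
    simpa using norm_add_le (A k k) (r - A k k)
  have h2 := Finset.add_sum_erase Finset.univ (fun j => ‖A k j‖) (Finset.mem_univ k)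
  linarith [hA k]

end Matrix

/-! ### The logarithm series of a finite product -/

theorem hasSum_pow_succ_div (z : ℂ) (hz : ‖z‖ < 1) :
    HasSum (fun n : ℕ => z ^ (n + 1) / (n + 1)) (-Complex.log (1 - z)) := by
  have h := (hasSum_nat_add_iff' 1).2 (Complex.hasSum_taylorSeries_neg_log hz)
  simpa using h

/-- L is the sum of the principal values -log(1 - ur); only exp(-L) is asserted, so branches of the
logarithm of the product play no role. -/
theorem exists_hasSum_multiset_pow (m : Multiset ℂ) (u : ℂ) (hm : ∀ r ∈ m, ‖u * r‖ < 1) :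
    ∃ L : ℂ, HasSum (fun n : ℕ => u ^ (n + 1) / (n + 1) * (m.map fun r => r ^ (n + 1)).sum) L ∧
      Complex.exp (-L) = (m.map fun r => 1 - u * r).prod := by
  induction m using Multiset.induction_on with
  | empty => exact ⟨0, by simp, by simp⟩
  | cons a m ih =>
    obtain ⟨L, hL, hexp⟩ := ih fun r hr => hm r (Multiset.mem_cons_of_mem hr)
    have ha := hm a (Multiset.mem_cons_self a m)
    refine ⟨-Complex.log (1 - u * a) + L, ((hasSum_pow_succ_div _ ha).add hL).congr_fun
      fun n => ?_, ?_⟩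
    · rw [Multiset.map_cons, Multiset.sum_cons]
      ring
    · have hne : 1 - u * a ≠ 0 := by
        intro h
        rw [← sub_eq_zero.1 h, norm_one] at ha
        exact lt_irrefl _ ha
      rw [Multiset.map_cons, Multiset.prod_cons, ← hexp, neg_add, neg_neg, Complex.exp_add,
        Complex.exp_log hne]

namespace Matrix

variable {n : Type*} [Fintype n] [DecidableEq n]

/-- `det (1 - u A) = exp (- ∑ uᵐ tr(Aᵐ) / m)` for small `u`. -/
theorem exists_hasSum_trace_pow {A : Matrix n n ℂ} {W : ℝ} (hA : ∀ i, ∑ j, ‖A i j‖ ≤ W) {u : ℂ}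
    (hu : ‖u‖ * W < 1) :
    ∃ L : ℂ, HasSum (fun m : ℕ => u ^ (m + 1) / (m + 1) * (A ^ (m + 1)).trace) L ∧
      Complex.exp (-L) = (1 - u • A).det := by
  have h := exists_hasSum_multiset_pow A.charpoly.roots u fun r hr => by
    rw [norm_mul]
    exact (mul_le_mul_of_nonneg_left (norm_root_charpoly_le hA hr) (norm_nonneg u)).trans_lt hu
  simpa only [trace_pow_eq_sum_roots, det_one_sub_smul_eq_prod_roots] using h

/-- The free end weight g makes the induction on walks work; g j = B j i later closes the walk up at
i. -/
theorem sum_path_eq_sum_pow (B : Matrix n n ℂ) (g : n → ℂ) (m : ℕ) (i : n) :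
    ∑ t : Fin m → n, (∏ k : Fin m, B ((Fin.cons i t : Fin (m + 1) → n) k.castSucc) (t k)) *
      g ((Fin.cons i t : Fin (m + 1) → n) (Fin.last m)) = ∑ j, (B ^ m) i j * g j := by
  induction m generalizing i with
  | zero => simp [Matrix.one_apply]
  | succ m ih =>
    rw [← (Fin.consEquiv fun _ => n).sum_comp, Fintype.sum_prod_type]
    have h1 : ∀ j, ∑ t : Fin m → n,
        (∏ k : Fin (m + 1), B ((Fin.cons i (Fin.cons j t : Fin (m + 1) → n) : Fin (m + 2) → n)
          k.castSucc) ((Fin.cons j t : Fin (m + 1) → n) k)) *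
          g ((Fin.cons i (Fin.cons j t : Fin (m + 1) → n) : Fin (m + 2) → n) (Fin.last (m + 1))) =
        B i j * ∑ l, (B ^ m) j l * g l := by
      intro j
      rw [← ih j, Finset.mul_sum]
      refine Finset.sum_congr rfl fun t _ => ?_
      rw [Fin.prod_univ_succ]
      simp only [Fin.castSucc_zero, Fin.cons_zero, Fin.cons_succ, ← Fin.succ_castSucc,
        ← Fin.succ_last]
      ring
    refine (Finset.sum_congr rfl fun j _ => h1 j).trans ?_
    simp only [pow_succ', Matrix.mul_apply, Finset.sum_mul, Finset.mul_sum, mul_assoc]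
    exact Finset.sum_comm

/-- The trace of a power as a sum over closed walks. -/
theorem trace_pow_succ (B : Matrix n n ℂ) (m : ℕ) :
    (B ^ (m + 1)).trace = ∑ s : Fin (m + 1) → n, ∏ k, B (s k) (s (k + 1)) := by
  rw [← (Fin.consEquiv fun _ => n).sum_comp, Fintype.sum_prod_type, Matrix.trace]
  refine Finset.sum_congr rfl fun i _ => ?_
  rw [pow_succ, Matrix.diag_apply, Matrix.mul_apply, ← sum_path_eq_sum_pow B (fun j => B j i) m i]
  refine Finset.sum_congr rfl fun t _ => ?_
  rw [Fin.prod_univ_castSucc]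
  simp [Fin.consEquiv]

end Matrix
end

noncomputable section

/-! ### Closed paths, their periods, and prime cycles -/

namespace WeightedGraph

universe u
variable {V : Type u} {X : SimpleGraph V}

namespace ClosedPath

/-- A closed path of length 1 would be a loop. Consequently index 1 is an interior position of every
closed path, where reducedness can be tested. -/
theorem two_le_length (p : ClosedPath X) : 2 ≤ p.length := by
  by_contra h
  have h1 : p.length = 1 := by have := p.length_pos; omega
  have h2 := p.periodic 0
  rw [h1] at h2
  exact (p.adj 0).ne h2.symm

theorem length_iterate_shift (p : ClosedPath X) (i : ℕ) : (shift^[i] p).length = p.length := by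
  induction i with
  | zero => rfl
  | succ i ih => rw [Function.iterate_succ_apply']; exact ih

theorem vert_iterate_shift (p : ClosedPath X) (i j : ℕ) :
    (shift^[i] p).vert j = p.vert (j + i) := by
  induction i generalizing j with
  | zero => rfl
  | succ i ih =>
    rw [Function.iterate_succ_apply']
    exact (ih (j + 1)).trans (by rw [add_assoc, add_comm 1 i])

theorem iterate_shift_mul_length (p : ClosedPath X) (i : ℕ) : shift^[i * p.length] p = p :=
  ClosedPath.ext (length_iterate_shift p _) (funext fun j =>
    (vert_iterate_shift p _ j).trans (Function.Periodic.nat_mul (f := p.vert) p.periodic i j))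

theorem iterate_shift_mod (p : ClosedPath X) (i : ℕ) :
    shift^[i % p.length] p = shift^[i] p := by
  conv_rhs => rw [← Nat.mod_add_div' i p.length, Function.iterate_add_apply,
    iterate_shift_mul_length]

theorem mk_shift (p : ClosedPath X) : PathClass.mk p.shift = PathClass.mk p :=
  (Quotient.sound (s := shiftSetoid X) (Relation.EqvGen.rel p p.shift rfl)).symm

theorem mk_iterate_shift (p : ClosedPath X) (i : ℕ) :
    PathClass.mk (shift^[i] p) = PathClass.mk p := by
  induction i with
  | zero => rfl
  | succ i ih => rw [Function.iterate_succ_apply', mk_shift, ih]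

theorem mk_eq_mk_iff {p q : ClosedPath X} :
    PathClass.mk p = PathClass.mk q ↔ ∃ i < p.length, q = shift^[i] p := by
  constructor
  · intro h
    have h' : Relation.EqvGen (fun p q : ClosedPath X => q = p.shift) p q := Quotient.exact h
    clear h
    suffices h : ∃ i, q = shift^[i] p by
      obtain ⟨i, rfl⟩ := h
      exact ⟨i % p.length, Nat.mod_lt _ p.length_pos, (iterate_shift_mod p i).symm⟩
    induction h' with
    | rel p q h => exact ⟨1, h⟩
    | refl p => exact ⟨0, rfl⟩
    | symm p q _ h =>
      obtain ⟨i, rfl⟩ := h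
      -- Rotating by i times the length is the identity, so this many further rotations undo i of
      -- them.
      refine ⟨i * p.length - i, ?_⟩
      rw [← Function.iterate_add_apply, Nat.sub_add_cancel (Nat.le_mul_of_pos_right i p.length_pos),
        iterate_shift_mul_length]
    | trans p q r _ _ h h' =>
      obtain ⟨i, rfl⟩ := h
      obtain ⟨j, rfl⟩ := h'
      exact ⟨j + i, (Function.iterate_add_apply _ _ _ _).symm⟩
  · rintro ⟨i, -, rfl⟩
    exact (mk_iterate_shift p i).symm

/-- The path has no backtracking, not even at its ends. -/
def NonBacktracking (p : ClosedPath X) : Prop := ∀ i, p.vert i ≠ p.vert (i + 2)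

/-- Every position, the end point included, becomes an interior one after a rotation, so reducedness
of all rotations is absence of backtracking along the whole periodic sequence. -/
theorem isCycle_mk_iff {p : ClosedPath X} :
    (PathClass.mk p).IsCycle ↔ p.NonBacktracking := by
  constructor
  · intro h i
    have h1 := h (shift^[i] p) (mk_iterate_shift p i) 1 le_rfl
      (by rw [length_iterate_shift]; exact p.two_le_length)
    rw [vert_iterate_shift, vert_iterate_shift] at h1
    simpa [add_comm] using h1
  · intro h q hq j hj _
    obtain ⟨i, -, rfl⟩ := mk_eq_mk_iff.1 hq.symm
    rw [vert_iterate_shift, vert_iterate_shift]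
    have := h (j - 1 + i)
    rwa [show j - 1 + i + 2 = j + 1 + i by omega] at this

/-- The least period of the sequence of vertices of a closed path. -/
def period (p : ClosedPath X) : ℕ :=
  Function.minimalPeriod (fun (v : ℕ → V) i => v (i + 1)) p.vert

theorem isPeriodicPt_iff (v : ℕ → V) (n : ℕ) :
    Function.IsPeriodicPt (fun (v : ℕ → V) i => v (i + 1)) n v ↔ ∀ i, v (i + n) = v i := by
  have h : ∀ n (v : ℕ → V), (fun (v : ℕ → V) i => v (i + 1))^[n] v = fun i => v (i + n) := by
    intro n
    induction n with
    | zero => intro v; rfl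
    | succ n ih =>
      intro v
      rw [Function.iterate_succ_apply, ih]
      funext i
      rw [add_assoc]
  rw [Function.IsPeriodicPt, Function.IsFixedPt, h, funext_iff]

theorem period_dvd {p : ClosedPath X} {n : ℕ} (h : ∀ i, p.vert (i + n) = p.vert i) :
    p.period ∣ n :=
  ((isPeriodicPt_iff _ _).2 h).minimalPeriod_dvd

theorem period_pos (p : ClosedPath X) : 0 < p.period :=
  Function.IsPeriodicPt.minimalPeriod_pos p.length_pos ((isPeriodicPt_iff _ _).2 p.periodic)

/-- The closed path that runs once through the sequence of vertices of `p`. -/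
def root (p : ClosedPath X) : ClosedPath X where
  length := p.period
  length_pos := p.period_pos
  vert := p.vert
  periodic := (isPeriodicPt_iff _ _).1 (Function.isPeriodicPt_minimalPeriod _ _)
  adj := p.adj

theorem exists_root_pow_eq (p : ClosedPath X) : ∃ j : ℕ+, p.root.pow j = p := by
  obtain ⟨j, hj⟩ := period_dvd p.periodic
  have hj0 : 0 < j := Nat.pos_of_ne_zero fun h => p.length_pos.ne' (by rw [hj, h, mul_zero])
  exact ⟨⟨j, hj0⟩, ClosedPath.ext ((mul_comm _ _).trans hj.symm) rfl⟩

/-- If the least period is smaller than the length, the path is a power of its root. Conversely, if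
its class is the j-th power of d, then the length of d is a period of its vertices. -/
theorem isPrimeCycle_mk_iff {p : ClosedPath X} :
    (PathClass.mk p).IsPrimeCycle ↔ p.NonBacktracking ∧ p.period = p.length := by
  rw [PathClass.IsPrimeCycle, isCycle_mk_iff]
  refine and_congr_right fun hp => ?_
  have hle : p.period ≤ p.length := Nat.le_of_dvd p.length_pos (period_dvd p.periodic)
  constructor
  · intro h
    by_contra hne
    obtain ⟨j, hj⟩ := p.exists_root_pow_eq
    refine h (PathClass.mk p.root) (isCycle_mk_iff.2 hp) j (lt_of_le_of_ne hle hne) ?_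
    exact congrArg PathClass.mk hj.symm
  · intro h d _ j hlt heq
    induction d using Quotient.inductionOn with
    | h q =>
    have hq : PathClass.mk (q.pow j) = PathClass.mk p := heq.symm
    obtain ⟨i, -, rfl⟩ := mk_eq_mk_iff.1 hq
    have hdvd : (shift^[i] (q.pow j)).period ∣ q.length := period_dvd fun l => by
      rw [vert_iterate_shift, vert_iterate_shift, add_right_comm]
      exact q.periodic _
    rw [h] at hdvd
    exact absurd (Nat.le_of_dvd q.length_pos hdvd) (not_le.2 hlt)

theorem edge_periodic (p : ClosedPath X) : Function.Periodic p.edge p.length := fun i => by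
  apply SimpleGraph.Dart.ext
  simp only [edge, p.periodic, add_right_comm i p.length 1]

theorem weight_pow (w : X.Dart → ℝ) (p : ClosedPath X) (j : ℕ+) :
    (p.pow j).weight w = p.weight w ^ (j : ℕ) := by
  have h : ∀ n : ℕ, ∏ i ∈ Finset.range (n * p.length), w (p.edge i) = p.weight w ^ n := by
    intro n
    induction n with
    | zero => simp
    | succ n ih =>
      rw [add_mul, one_mul, Finset.prod_range_add, ih, pow_succ, weight]
      congr 1
      refine Finset.prod_congr rfl fun i _ => ?_
      rw [add_comm]
      exact congrArg w (p.edge_periodic.nat_mul n i)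
  exact h j

end ClosedPath

open ClosedPath

/-- The closed paths without backtracking. -/
abbrev NonBacktrackingPath (X : SimpleGraph V) : Type u :=
  {p : ClosedPath X // p.NonBacktracking}

/-- The closed paths whose class is a prime cycle. -/
abbrev PrimePath (X : SimpleGraph V) : Type u :=
  {p : ClosedPath X // p.NonBacktracking ∧ p.period = p.length}

/-- Every closed path without backtracking is a power of a unique prime one. -/
def primePathPowEquiv : PrimePath X × ℕ+ ≃ NonBacktrackingPath X :=
  Equiv.ofBijective (fun a => ⟨a.1.1.pow a.2, a.1.2.1⟩) <| by
    constructor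
    · rintro ⟨⟨q, hq⟩, j⟩ ⟨⟨q', hq'⟩, j'⟩ h
      have h1 : q.pow j = q'.pow j' := congrArg Subtype.val h
      have hv : (q.pow j).vert = (q'.pow j').vert := congrArg ClosedPath.vert h1
      change q.vert = q'.vert at hv
      have hl : (q.pow j).length = (q'.pow j').length := congrArg ClosedPath.length h1
      change (j : ℕ) * q.length = j' * q'.length at hl
      have hq0 : q.length = q'.length := by
        rw [← hq.2, ← hq'.2, period, period, hv]
      obtain rfl : q = q' := ClosedPath.ext hq0 hv
      have hj : j = j' := PNat.coe_injective (Nat.eq_of_mul_eq_mul_right q.length_pos hl)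
      rw [hj]
    · rintro ⟨p, hp⟩
      obtain ⟨j, hj⟩ := p.exists_root_pow_eq
      exact ⟨⟨⟨p.root, hp, rfl⟩, j⟩, Subtype.ext hj⟩

/-- The prime cycle of a prime closed path. -/
def PrimePath.toCycle (q : PrimePath X) : PrimeCycle X :=
  ⟨PathClass.mk q.1, isPrimeCycle_mk_iff.2 q.2⟩

/-- The representatives are the rotations; two rotations agree only if their offsets differ by a
multiple of the least period, which here is the length. -/
theorem card_primePath_fiber (P : PrimeCycle X) :
    Nat.card {q : PrimePath X // q.toCycle = P} = P.1.length := by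
  obtain ⟨P, hP⟩ := P
  induction P using Quotient.inductionOn with
  | h p =>
  have hp := isPrimeCycle_mk_iff.1 hP
  let f : Fin p.length → {q : PrimePath X // q.toCycle = ⟨PathClass.mk p, hP⟩} := fun i =>
    ⟨⟨shift^[i] p, isPrimeCycle_mk_iff.1 (by rw [mk_iterate_shift]; exact hP)⟩,
      Subtype.ext (mk_iterate_shift p i)⟩
  have hf : Function.Bijective f := by
    constructor
    · have key : ∀ i j : Fin p.length, i ≤ j → f i = f j → i = j := by
        intro i j hle hij
        have h1 : shift^[i] p = shift^[j] p := congrArg (fun q => q.1.1) hij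
        have h2 : p.period ∣ (j : ℕ) - i := by
          refine period_dvd fun l => ?_
          -- Evaluating at l + (length - i) cancels the offset i modulo the length without
          -- subtracting below zero.
          have h3 := congrArg (fun q => q.vert (l + (p.length - i))) h1
          simp only [vert_iterate_shift] at h3
          have hi := i.2
          have hij : (i : ℕ) ≤ j := hle
          rw [show l + (p.length - i) + i = l + p.length by omega,
            show l + (p.length - i) + j = l + (j - i) + p.length by omega,
            p.periodic, p.periodic] at h3
          exact h3.symm
        rw [hp.2] at h2
        have h4 := Nat.eq_zero_of_dvd_of_lt h2 (by have := j.2; omega)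
        have hij : (i : ℕ) ≤ j := hle
        exact Fin.ext (by omega)
      intro i j hij
      rcases le_total i j with h | h
      · exact key i j h hij
      · exact (key j i h hij.symm).symm
    · rintro ⟨⟨q, hq⟩, hqP⟩
      obtain ⟨i, hi, rfl⟩ := mk_eq_mk_iff.1 (congrArg Subtype.val hqP).symm
      exact ⟨⟨i, hi⟩, rfl⟩
  exact (Nat.card_congr (Equiv.ofBijective f hf)).symm.trans (Nat.card_fin _)

/-- The Euler product over prime cycles, from the sum over all closed paths without
backtracking. -/
theorem hasProd_eulerFactor {w : X.Dart → ℝ} {u S : ℂ}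
    (hlt : ∀ p : ClosedPath X, ‖(p.weight w : ℂ) * u ^ p.length‖ < 1)
    (hS : HasSum (fun p : NonBacktrackingPath X =>
      (p.1.weight w : ℂ) * u ^ p.1.length / p.1.length) S) :
    HasProd (eulerFactor w u) (Complex.exp S) := by
  have h1 := (primePathPowEquiv (X := X)).hasSum_iff.2 hS
  have h2 : HasSum (fun q : PrimePath X =>
      -Complex.log (1 - (q.1.weight w : ℂ) * u ^ q.1.length) / q.1.length) S := by
    -- Summing over the powers of a fixed prime path q: the j-th power contributes zʲ/(jl) with z =
    -- w(q)uˡ, so the total is -log(1 - z)/l.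
    refine h1.prod_fiberwise fun q => ?_
    have hl : (q.1.length : ℂ) ≠ 0 := by exact_mod_cast q.1.length_pos.ne'
    have h3 := (hasSum_pow_succ_div _ (hlt q.1)).div_const (q.1.length : ℂ)
    refine (Equiv.pnatEquivNat.symm.hasSum_iff (f := fun j : ℕ+ => _)).1 (h3.congr_fun fun n => ?_)
    have hw : ((q.1.pow n.succPNat).weight w : ℂ) = (q.1.weight w : ℂ) ^ (n + 1) := by
      rw [weight_pow]; simp
    have hn : ((n : ℂ) + 1) ≠ 0 := by exact_mod_cast n.succ_ne_zero
    change ((q.1.pow n.succPNat).weight w : ℂ) * u ^ ((n + 1) * q.1.length) /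
      (((n + 1) * q.1.length : ℕ) : ℂ) = _
    rw [hw]
    push_cast
    rw [mul_pow, ← pow_mul, mul_comm q.1.length]
    field_simp
  have h4 := (Equiv.sigmaFiberEquiv (PrimePath.toCycle (X := X))).hasSum_iff.2 h2
  have h5 : HasSum (fun P : PrimeCycle X =>
      -Complex.log (1 - (P.1.weight w : ℂ) * u ^ P.1.length)) S := by
    -- The l representatives of a prime cycle contribute equally, which cancels the division by l.
    refine h4.sigma fun P => ?_
    have hcard := card_primePath_fiber P
    have hl : 0 < P.1.length := by
      obtain ⟨P, hP⟩ := P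
      induction P using Quotient.inductionOn with
      | h p => exact p.length_pos
    have := Nat.finite_of_card_ne_zero (hcard.trans_ne hl.ne')
    have := Fintype.ofFinite {q : PrimePath X // q.toCycle = P}
    have hl' : (P.1.length : ℂ) ≠ 0 := by exact_mod_cast hl.ne'
    have hconst : HasSum (fun _ : {q : PrimePath X // q.toCycle = P} =>
        -Complex.log (1 - (P.1.weight w : ℂ) * u ^ P.1.length) / P.1.length)
        (-Complex.log (1 - (P.1.weight w : ℂ) * u ^ P.1.length)) := by
      convert hasSum_fintype (fun _ : {q : PrimePath X // q.toCycle = P} =>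
        -Complex.log (1 - (P.1.weight w : ℂ) * u ^ P.1.length) / P.1.length) using 1
      rw [Finset.sum_const, Finset.card_univ, ← Nat.card_eq_fintype_card, hcard, nsmul_eq_mul,
        mul_div_cancel₀ _ hl']
    refine hconst.congr_fun ?_
    rintro ⟨q, rfl⟩
    rfl
  refine h5.cexp.congr_fun ?_
  rintro ⟨P, hP⟩
  induction P using Quotient.inductionOn with
  | h p =>
  have hne : 1 - (p.weight w : ℂ) * u ^ p.length ≠ 0 := by
    intro h
    have := hlt p
    rw [← sub_eq_zero.1 h, norm_one] at this
    exact lt_irrefl _ this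
  exact (((Complex.exp_neg _).trans (congrArg _ (Complex.exp_log hne)))).symm

end WeightedGraph
end

noncomputable section

/-! ### The Fredholm determinant of the edge transfer operator -/

/-! ### Summability bounds and limits over growing finite sets -/

section Limits

open Filter Topology

/-- The square of the term is ab with a = (4x²)ᵏ/k! and b = 4⁻ᵏ, and ab ≤ (a + b)² for nonnegative
a, b, so the term is dominated by an exponential plus a geometric series. -/
theorem summable_pow_mul_sqrt_factorial_div (x : ℝ) (hx : 0 ≤ x) :
    Summable fun k : ℕ => x ^ k * (√k.factorial / k.factorial) := by
  refine ((Real.summable_pow_div_factorial (4 * x ^ 2)).add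
    (summable_geometric_of_lt_one (r := 1 / 4) (by norm_num) (by norm_num))).of_nonneg_of_le
    (fun k => by positivity) fun k => ?_
  have hk : (0 : ℝ) < k.factorial := by exact_mod_cast k.factorial_pos
  refine abs_le_of_sq_le_sq' ?_ (by positivity) |>.2
  have h1 : (x ^ k * (√k.factorial / k.factorial)) ^ 2 =
      (4 * x ^ 2) ^ k / k.factorial * (1 / 4) ^ k := by
    rw [mul_pow, div_pow, Real.sq_sqrt hk.le, mul_pow, div_mul_eq_mul_div, mul_right_comm,
      ← mul_pow 4, ← pow_mul, ← pow_mul, mul_comm k 2]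
    norm_num
    field_simp
  rw [h1]
  have ha : 0 ≤ (4 * x ^ 2) ^ k / (k.factorial : ℝ) := by positivity
  have hb : (0 : ℝ) ≤ (1 / 4) ^ k := by positivity
  nlinarith [mul_nonneg ha hb]

/-- Dominated convergence for a series of sums over tuples from growing finite sets. -/
theorem tendsto_tsum_sum_tuple {E : Type*} {l : ℕ → ℕ} {g : ∀ k, (Fin (l k) → E) → ℂ}
    {B : ℕ → ℝ} (hB : Summable B)
    (hg : ∀ k, Summable fun s => ‖g k s‖) (hgB : ∀ k, ∑' s, ‖g k s‖ ≤ B k) :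
    Tendsto (fun F : Finset E => ∑' k, ∑ s : Fin (l k) → F, g k (fun i => s i)) atTop
      (𝓝 (∑' k, ∑' s, g k s)) := by
  refine tendsto_tsum_of_dominated_convergence hB
    (fun k => tendsto_sum_tuple (hg k).of_norm) (Eventually.of_forall fun F k => ?_)
  rw [sum_tuple_subtype]
  exact (norm_sum_le _ _).trans
    (((hg k).sum_le_tsum _ fun s _ => norm_nonneg _).trans (hgB k))

end Limits

/-! ### The edge matrix, its minors, and its cyclic products -/

namespace WeightedGraph

open Filter Topology ClosedPath

universe u
variable {V : Type u} {X : SimpleGraph V}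

open scoped Classical in
/-- The matrix of the edge transfer operator; the row of `e` holds the coefficients of `T e`. -/
def transferMatrix (w : X.Dart → ℝ) : Matrix X.Dart X.Dart ℂ :=
  Matrix.of fun e e' => if Follows e e' then (w e' : ℂ) else 0

theorem orthonormal_unitVec : Orthonormal ℂ (unitVec (X := X)) := by
  classical
  rw [orthonormal_iff_ite]
  exact fun e e' => inner_unitVec e e'

variable {w : X.Dart → ℝ}

theorem inner_unitVec_transferVec (hX : BoundedValency X) (e e' : X.Dart) :
    inner ℂ (unitVec e) (transferVec w e') = transferMatrix w e' e := by
  classical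
  have := finite_follows hX e'
  have := Fintype.ofFinite {f : X.Dart // Follows e' f}
  rw [transferVec, tsum_fintype, inner_sum, transferMatrix, Matrix.of_apply]
  simp only [inner_smul_right, inner_unitVec, mul_ite, mul_one, mul_zero]
  split_ifs with h
  · rw [Finset.sum_eq_single ⟨e, h⟩]
    · simp
    · intro f _ hf
      rw [if_neg fun hef => hf (Subtype.ext hef.symm)]
    · simp
  · refine Finset.sum_eq_zero fun f _ => if_neg fun hef => h ?_
    rw [hef]
    exact f.2

theorem hasSum_transferOp (hX : BoundedValency X) (hw : ∀ e, 0 < w e) (hsum : Summable w)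
    (v : L2OE X) :
    HasSum (fun e => inner ℂ (unitVec e) v • transferVec w e) (transferOp w v) := by
  have hs : Summable fun e : X.Dart =>
      InnerProductSpace.rankOne ℂ (transferVec w e) (unitVec e) := by
    refine Summable.of_norm ?_
    simpa [InnerProductSpace.norm_rankOne, norm_unitVec] using summable_norm_transferVec hX hw hsum
  exact hs.hasSum.mapL (ContinuousLinearMap.apply ℂ (L2OE X) v)

theorem isTraceClass_transferOp (hX : BoundedValency X) (hw : ∀ e, 0 < w e) (hsum : Summable w) :
    TraceClass.IsTraceClass (transferOp w) :=
  TraceClass.isTraceClass_of_nuclear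
    (by simpa only [norm_unitVec, mul_one] using summable_norm_transferVec hX hw hsum)
    (hasSum_transferOp hX hw hsum)

/-- The two matrices are transposes of each other, because rows of the edge matrix hold the images
of the basis vectors. -/
theorem det_inner_unitVec_transferVec (hX : BoundedValency X) {k : ℕ} (s : Fin k → X.Dart) :
    (Matrix.of fun i j => inner ℂ (unitVec (s i)) (transferVec w (s j))).det =
      ((transferMatrix w).submatrix s s).det := by
  rw [← Matrix.det_transpose]
  congr 1
  ext i j
  exact inner_unitVec_transferVec hX _ _

/-- The `k`-th coefficient of the Fredholm determinant, up to sign. -/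
def fredholmCoeff (w : X.Dart → ℝ) (k : ℕ) : ℂ :=
  ∑' s : Fin k → X.Dart, (k.factorial : ℂ)⁻¹ * ((transferMatrix w).submatrix s s).det

theorem summable_norm_minor (hX : BoundedValency X) (hw : ∀ e, 0 < w e) (hsum : Summable w)
    (k : ℕ) :
    (Summable fun s : Fin k → X.Dart =>
      ‖(k.factorial : ℂ)⁻¹ * ((transferMatrix w).submatrix s s).det‖) ∧
    ∑' s : Fin k → X.Dart, ‖(k.factorial : ℂ)⁻¹ * ((transferMatrix w).submatrix s s).det‖ ≤
      (∑' e, ‖transferVec w e‖) ^ k * (√k.factorial / k.factorial) := by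
  obtain ⟨h1, h2⟩ := summable_prod_tuple (k := k) (fun e => norm_nonneg (transferVec w e))
    (summable_norm_transferVec hX hw hsum)
  have hle : ∀ s : Fin k → X.Dart,
      ‖(k.factorial : ℂ)⁻¹ * ((transferMatrix w).submatrix s s).det‖ ≤
        (√k.factorial / k.factorial) * ∏ i, ‖transferVec w (s i)‖ := by
    intro s
    rw [norm_mul, norm_inv, Complex.norm_natCast, ← det_inner_unitVec_transferVec hX]
    refine (mul_le_mul_of_nonneg_left (HilbertExterior.norm_minor_le orthonormal_unitVec s)
      (by positivity)).trans (le_of_eq ?_)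
    ring
  have h3 := h1.mul_left (√k.factorial / k.factorial : ℝ)
  have h4 := h3.of_nonneg_of_le (fun s => norm_nonneg _) hle
  refine ⟨h4, (h4.tsum_le_tsum hle h3).trans ?_⟩
  rw [tsum_mul_left, mul_comm]
  exact mul_le_mul_of_nonneg_right h2 (by positivity)

theorem norm_fredholmCoeff_le (hX : BoundedValency X) (hw : ∀ e, 0 < w e) (hsum : Summable w)
    (k : ℕ) :
    ‖fredholmCoeff w k‖ ≤ (∑' e, ‖transferVec w e‖) ^ k * (√k.factorial / k.factorial) :=
  (norm_tsum_le_tsum_norm (summable_norm_minor hX hw hsum k).1).trans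
    (summable_norm_minor hX hw hsum k).2

/-- The Fredholm determinant `det (1 - u T)` as a power series in `u`. -/
def fredholmDet (w : X.Dart → ℝ) (u : ℂ) : ℂ := ∑' k : ℕ, (-u) ^ k * fredholmCoeff w k

theorem summable_fredholm_bound (w : X.Dart → ℝ) {R : ℝ} (hR : 0 ≤ R) :
    Summable fun k : ℕ =>
      R ^ k * ((∑' e, ‖transferVec w e‖) ^ k * (√k.factorial / k.factorial)) := by
  have h0 : 0 ≤ ∑' e, ‖transferVec w e‖ := tsum_nonneg fun e => norm_nonneg _
  simpa only [mul_pow, mul_assoc] using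
    summable_pow_mul_sqrt_factorial_div (R * ∑' e, ‖transferVec w e‖) (mul_nonneg hR h0)

theorem hasSum_fredholmDet (hX : BoundedValency X) (hw : ∀ e, 0 < w e) (hsum : Summable w)
    (u : ℂ) : HasSum (fun k : ℕ => (-u) ^ k * fredholmCoeff w k) (fredholmDet w u) := by
  refine (Summable.of_norm_bounded (summable_fredholm_bound w (norm_nonneg u)) fun k => ?_).hasSum
  rw [norm_mul, norm_pow, norm_neg]
  exact mul_le_mul_of_nonneg_left (norm_fredholmCoeff_le hX hw hsum k) (by positivity)

/-- The series of polynomials converges uniformly on every ball about 0, so its sum is holomorphic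
there. -/
theorem differentiable_fredholmDet (hX : BoundedValency X) (hw : ∀ e, 0 < w e)
    (hsum : Summable w) : Differentiable ℂ (fredholmDet w) := by
  intro u
  have h : DifferentiableOn ℂ (fredholmDet w) (Metric.ball 0 (‖u‖ + 1)) := by
    refine Complex.differentiableOn_tsum_of_summable_norm
      (summable_fredholm_bound w (R := ‖u‖ + 1) (by positivity)) (fun k => ?_)
      Metric.isOpen_ball fun k z hz => ?_
    · fun_prop
    · rw [norm_mul, norm_pow, norm_neg]
      have hz' : ‖z‖ ≤ ‖u‖ + 1 := (mem_ball_zero_iff.1 hz).le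
      exact mul_le_mul (pow_le_pow_left₀ (norm_nonneg _) hz' k)
        (norm_fredholmCoeff_le hX hw hsum k) (norm_nonneg _) (by positivity)
  exact h.differentiableAt (Metric.isOpen_ball.mem_nhds (by simp))

/-- The operator uT is nuclear with vectors u·Te, so each k×k minor acquires uᵏ, which combines with
(-1)ᵏ to (-u)ᵏ. -/
theorem hasFredholmDet_smul_transferOp (hX : BoundedValency X) (hw : ∀ e, 0 < w e)
    (hsum : Summable w) (u : ℂ) :
    TraceClass.HasFredholmDet (u • transferOp w) (fredholmDet w u) := by
  have hx : Summable fun e => ‖u • transferVec w e‖ := by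
    simpa only [norm_smul] using (summable_norm_transferVec hX hw hsum).mul_left ‖u‖
  have hT : ∀ v, HasSum (fun e => inner ℂ (unitVec e) v • (u • transferVec w e))
      ((u • transferOp w) v) := fun v => by
    have h := (hasSum_transferOp hX hw hsum v).const_smul u
    simp only [smul_comm u] at h
    exact h
  refine ⟨TraceClass.isTraceClass_powerMap hx orthonormal_unitVec hT,
    (hasSum_fredholmDet hX hw hsum u).congr_fun fun k => ?_⟩
  rw [TraceClass.trace_powerMap hx orthonormal_unitVec hT, fredholmCoeff, neg_pow u, mul_assoc,
    ← tsum_mul_left (a := u ^ k)]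
  congr 1
  refine tsum_congr fun s => ?_
  have h : (Matrix.of fun i j => inner ℂ (unitVec (s i)) (u • transferVec w (s j))) =
      u • Matrix.of fun i j => inner ℂ (unitVec (s i)) (transferVec w (s j)) := by
    ext i j
    simp
  rw [h, Matrix.det_smul, det_inner_unitVec_transferVec hX, Fintype.card_fin]
  ring

/-- The weight of a cyclic sequence of oriented edges, zero unless each may follow the previous
one, divided by its length. -/
def cyclicTerm (w : X.Dart → ℝ) (u : ℂ) (m : ℕ) (s : Fin (m + 1) → X.Dart) : ℂ :=
  u ^ (m + 1) / (m + 1) * ∏ k, transferMatrix w (s k) (s (k + 1))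

theorem norm_transferMatrix_le (hw : ∀ e, 0 < w e) (e e' : X.Dart) :
    ‖transferMatrix w e e'‖ ≤ w e' := by
  rw [transferMatrix, Matrix.of_apply]
  split_ifs
  · rw [Complex.norm_real, Real.norm_of_nonneg (hw _).le]
  · simpa using (hw e').le

theorem summable_norm_cyclicTerm (hw : ∀ e, 0 < w e) (hsum : Summable w) (u : ℂ) (m : ℕ) :
    (Summable fun s => ‖cyclicTerm w u m s‖) ∧
      ∑' s, ‖cyclicTerm w u m s‖ ≤ (‖u‖ * ∑' e, w e) ^ (m + 1) := by
  obtain ⟨h1, h2⟩ := summable_prod_tuple (k := m + 1) (fun e => (hw e).le) hsum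
  have hle : ∀ s : Fin (m + 1) → X.Dart,
      ‖cyclicTerm w u m s‖ ≤ ‖u‖ ^ (m + 1) * ∏ k, w (s k) := by
    intro s
    rw [cyclicTerm, norm_mul, norm_div, norm_pow, norm_prod]
    refine mul_le_mul (div_le_self (by positivity) ?_) ?_ (by positivity) (by positivity)
    · have : ((m : ℂ) + 1) = ((m + 1 : ℕ) : ℂ) := by push_cast; rfl
      rw [this, Complex.norm_natCast]
      exact_mod_cast Nat.le_add_left 1 m
    · rw [← Equiv.prod_comp (Equiv.addRight (1 : Fin (m + 1))) fun k => w (s k)]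
      exact Finset.prod_le_prod (fun k _ => norm_nonneg _) fun k _ =>
        norm_transferMatrix_le hw _ _
  have h3 := h1.mul_left (‖u‖ ^ (m + 1))
  have h4 := h3.of_nonneg_of_le (fun s => norm_nonneg _) hle
  refine ⟨h4, (h4.tsum_le_tsum hle h3).trans ?_⟩
  rw [tsum_mul_left, mul_pow]
  exact mul_le_mul_of_nonneg_left h2 (by positivity)

/-- The identity det(1 - uB) = exp(-Σ uᵐ tr(Bᵐ)/m) holds for every compression B to a finite set of
edges, and both sides converge as the set grows, by bounds independent of it. -/
theorem fredholmDet_eq_exp (hX : BoundedValency X) (hw : ∀ e, 0 < w e) (hsum : Summable w)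
    {u : ℂ} (hu : ‖u‖ * ∑' e, w e < 1) :
    fredholmDet w u = Complex.exp (-∑' m, ∑' s, cyclicTerm w u m s) := by
  classical
  have hW : 0 ≤ ‖u‖ * ∑' e, w e := mul_nonneg (norm_nonneg _) (tsum_nonneg fun e => (hw e).le)
  have hgeom : Summable fun m : ℕ => (‖u‖ * ∑' e, w e) ^ (m + 1) :=
    (summable_nat_add_iff 1).2 (summable_geometric_of_lt_one hW hu)
  have h1 := tendsto_tsum_sum_tuple (l := fun m => m + 1) (g := cyclicTerm w u) hgeom
    (fun m => (summable_norm_cyclicTerm hw hsum u m).1)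
    fun m => (summable_norm_cyclicTerm hw hsum u m).2
  have h2 := (Complex.continuous_exp.tendsto _).comp h1.neg
  have h3 := tendsto_tsum_sum_tuple (l := fun k => k) (g := fun k (s : Fin k → X.Dart) =>
      (-u) ^ k * ((k.factorial : ℂ)⁻¹ * ((transferMatrix w).submatrix s s).det))
    (summable_fredholm_bound w (norm_nonneg u))
    (fun k => by
      simpa only [norm_mul ((-u) ^ k)] using
        (summable_norm_minor hX hw hsum k).1.mul_left ‖(-u) ^ k‖)
    (fun k => by
      simp only [norm_mul ((-u) ^ k)]
      rw [tsum_mul_left, norm_pow, norm_neg]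
      exact mul_le_mul_of_nonneg_left (summable_norm_minor hX hw hsum k).2 (by positivity))
  simp only [tsum_mul_left (a := (-u) ^ _)] at h3
  refine tendsto_nhds_unique h3 (h2.congr fun F => ?_)
  let B : Matrix F F ℂ := (transferMatrix w).submatrix Subtype.val Subtype.val
  -- Row sums of B are at most the total weight, so one condition on u serves all finite sets F.
  obtain ⟨L, hL, hexp⟩ := Matrix.exists_hasSum_trace_pow (A := B) (W := ∑' e, w e) (fun i => by
    refine (Finset.sum_le_sum fun j _ => norm_transferMatrix_le hw _ _).trans ?_
    rw [Finset.sum_coe_sort F w]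
    exact hsum.sum_le_tsum F fun e _ => (hw e).le) hu
  have hdet := Matrix.hasSum_det_one_add_smul B (-u)
  rw [neg_smul, ← sub_eq_add_neg, ← hexp] at hdet
  have hLsum : L = ∑' m, ∑ s : Fin (m + 1) → F, cyclicTerm w u m fun i => s i := by
    rw [← hL.tsum_eq]
    refine tsum_congr fun m => ?_
    rw [Matrix.trace_pow_succ, Finset.mul_sum]
    rfl
  simp only [Function.comp_apply]
  rw [← hLsum, ← hdet.tsum_eq]
  refine tsum_congr fun k => ?_
  rw [Finset.mul_sum, Finset.mul_sum]
  rfl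

/-- The cyclic sequence of oriented edges of a closed path. -/
def NonBacktrackingPath.edges (p : NonBacktrackingPath X) :
    Σ m : ℕ, Fin (m + 1) → X.Dart :=
  ⟨p.1.length - 1, fun k => p.1.edge k⟩

theorem NonBacktrackingPath.edges_injective :
    Function.Injective (NonBacktrackingPath.edges (X := X)) := by
  -- A left inverse up to encoding: reading indices modulo m + 1 recovers the length and the
  -- periodic vertex sequence, so dependent tuples need not be compared.
  let θ : (Σ m : ℕ, Fin (m + 1) → X.Dart) → ℕ × (ℕ → V) := fun a =>
    (a.1 + 1, fun i => (a.2 (Fin.ofNat (a.1 + 1) i)).fst)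
  have hθ : ∀ p : NonBacktrackingPath X, θ p.edges = (p.1.length, p.1.vert) := by
    intro p
    have hl : p.1.length - 1 + 1 = p.1.length := Nat.sub_add_cancel p.1.length_pos
    refine Prod.ext hl (funext fun i => ?_)
    change p.1.vert (i % (p.1.length - 1 + 1)) = p.1.vert i
    rw [hl]
    exact Function.Periodic.map_mod_nat p.1.periodic i
  intro p q h
  have h1 := congrArg θ h
  rw [hθ, hθ] at h1
  exact Subtype.ext (ClosedPath.ext (congrArg Prod.fst h1) (congrArg Prod.snd h1))

theorem cyclicTerm_edges (u : ℂ) (p : NonBacktrackingPath X) :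
    cyclicTerm w u p.edges.1 p.edges.2 = (p.1.weight w : ℂ) * u ^ p.1.length / p.1.length := by
  obtain ⟨⟨l, hl, v, hper, hadj⟩, hp⟩ := p
  obtain ⟨m, rfl⟩ := Nat.exists_eq_succ_of_ne_zero hl.ne'
  set p : ClosedPath X := ⟨m + 1, hl, v, hper, hadj⟩
  have hstep : ∀ k : Fin (m + 1), p.edge (k + 1 : Fin (m + 1)) = p.edge (k + 1) := by
    intro k
    have h1 : ((k + 1 : Fin (m + 1)) : ℕ) = ((k : ℕ) + 1) % (m + 1) := by
      rw [Fin.val_add, Fin.val_one', Nat.add_mod_mod]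
    rw [h1]
    exact p.edge_periodic.map_mod_nat _
  have hB : ∀ k : Fin (m + 1), transferMatrix w (p.edge k) (p.edge (k + 1 : Fin (m + 1))) =
      (w (p.edge (k + 1 : Fin (m + 1))) : ℂ) := by
    intro k
    rw [transferMatrix, Matrix.of_apply, if_pos]
    rw [hstep]
    refine ⟨rfl, fun h => hp k ?_⟩
    exact (congrArg (fun d : X.Dart => d.snd) h).symm
  change u ^ (m + 1) / ((m : ℂ) + 1) *
    ∏ k : Fin (m + 1), transferMatrix w (p.edge k) (p.edge (k + 1 : Fin (m + 1))) =
      (p.weight w : ℂ) * u ^ (m + 1) / ((m + 1 : ℕ) : ℂ)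
  have hw : (p.weight w : ℂ) = ∏ k : Fin (m + 1), (w (p.edge k) : ℂ) := by
    change ((∏ i ∈ Finset.range (m + 1), w (p.edge i) : ℝ) : ℂ) = _
    rw [Finset.prod_range]
    push_cast
    rfl
  rw [Finset.prod_congr rfl fun k _ => hB k, hw,
    ← Equiv.prod_comp (Equiv.addRight (1 : Fin (m + 1)))
      fun k : Fin (m + 1) => (w (p.edge k) : ℂ)]
  simp only [Equiv.coe_addRight]
  push_cast
  ring

/-- If no factor vanishes, each edge may follow its cyclic predecessor, so the origins form a closed
path; the condition e' ≠ e⁻¹ excludes backtracking, also across the closing point. -/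
theorem cyclicTerm_eq_zero (u : ℂ) (a : Σ m : ℕ, Fin (m + 1) → X.Dart)
    (ha : a ∉ Set.range (NonBacktrackingPath.edges (X := X))) : cyclicTerm w u a.1 a.2 = 0 := by
  obtain ⟨m, s⟩ := a
  by_contra hne
  have hfol : ∀ k, Follows (s k) (s (k + 1)) := by
    intro k
    by_contra hk
    refine hne (mul_eq_zero_of_right _ (Finset.prod_eq_zero (Finset.mem_univ k) ?_))
    rw [transferMatrix, Matrix.of_apply, if_neg hk]
  have hsucc : ∀ i : ℕ, Fin.ofNat (m + 1) (i + 1) = Fin.ofNat (m + 1) i + 1 := by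
    intro i
    ext
    simp [Fin.val_add]
  have hstep : ∀ i : ℕ, (s (Fin.ofNat (m + 1) (i + 1))).fst = (s (Fin.ofNat (m + 1) i)).snd := by
    intro i
    rw [hsucc]
    exact (hfol _).1
  let p : ClosedPath X :=
    { length := m + 1
      length_pos := m.succ_pos
      vert := fun i => (s (Fin.ofNat (m + 1) i)).fst
      periodic := fun i => by
        have h : Fin.ofNat (m + 1) (i + (m + 1)) = Fin.ofNat (m + 1) i :=
          Fin.ext (Nat.add_mod_right i (m + 1))
        rw [h]
      adj := fun i => by
        rw [hstep]
        exact (s _).adj }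
  have hp : p.NonBacktracking := by
    intro i h
    have h1 := (hfol (Fin.ofNat (m + 1) i)).2
    rw [← hsucc] at h1
    refine h1 (SimpleGraph.Dart.ext _ _ (Prod.ext (hstep i) ?_))
    exact (hstep (i + 1)).symm.trans h.symm
  refine ha ⟨⟨p, hp⟩, ?_⟩
  have hs : (fun k : Fin (m + 1) => p.edge k) = s := by
    funext k
    have hk : Fin.ofNat (m + 1) k = k := by ext; simp
    refine SimpleGraph.Dart.ext _ _ (Prod.ext ?_ ?_)
    · exact congrArg (fun j => (s j).fst) hk
    · exact (hstep k).trans (congrArg (fun j => (s j).snd) hk)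
  exact congrArg (Sigma.mk m) hs

theorem hasSum_nonBacktrackingPath (hw : ∀ e, 0 < w e) (hsum : Summable w) {u : ℂ}
    (hu : ‖u‖ * ∑' e, w e < 1) :
    HasSum (fun p : NonBacktrackingPath X => (p.1.weight w : ℂ) * u ^ p.1.length / p.1.length)
      (∑' m, ∑' s, cyclicTerm w u m s) := by
  have hW : 0 ≤ ‖u‖ * ∑' e, w e := mul_nonneg (norm_nonneg _) (tsum_nonneg fun e => (hw e).le)
  have hs : Summable fun a : Σ m : ℕ, Fin (m + 1) → X.Dart => cyclicTerm w u a.1 a.2 := by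
    refine Summable.of_norm ?_
    rw [summable_sigma_of_nonneg fun a => norm_nonneg _]
    exact ⟨fun m => (summable_norm_cyclicTerm hw hsum u m).1,
      ((summable_nat_add_iff 1).2 (summable_geometric_of_lt_one hW hu)).of_nonneg_of_le
        (fun m => tsum_nonneg fun s => norm_nonneg _)
        fun m => (summable_norm_cyclicTerm hw hsum u m).2⟩
  have h1 := hs.hasSum
  rw [hs.tsum_sigma] at h1
  refine ((NonBacktrackingPath.edges_injective.hasSum_iff
    fun a ha => cyclicTerm_eq_zero u a ha).2 h1).congr_fun fun p => ?_
  exact (cyclicTerm_edges u p).symm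

theorem norm_weight_mul_pow_lt_one (hw : ∀ e, 0 < w e) (hsum : Summable w) {u : ℂ}
    (hu : ‖u‖ * ∑' e, w e < 1) (p : ClosedPath X) :
    ‖(p.weight w : ℂ) * u ^ p.length‖ < 1 := by
  have hW : 0 ≤ ∑' e, w e := tsum_nonneg fun e => (hw e).le
  have h0 : 0 ≤ p.weight w := Finset.prod_nonneg fun i _ => (hw _).le
  have h1 : p.weight w ≤ (∑' e, w e) ^ p.length := by
    refine (Finset.prod_le_prod (fun i _ => (hw _).le) fun i _ =>
      hsum.le_tsum (p.edge i) fun e _ => (hw e).le).trans (le_of_eq ?_)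
    rw [Finset.prod_const, Finset.card_range]
  rw [norm_mul, norm_pow, Complex.norm_real, Real.norm_of_nonneg h0]
  calc p.weight w * ‖u‖ ^ p.length ≤ (∑' e, w e) ^ p.length * ‖u‖ ^ p.length := by gcongr
    _ = (‖u‖ * ∑' e, w e) ^ p.length := by rw [mul_comm, mul_pow]
    _ < 1 := pow_lt_one₀ (by positivity) hu p.length_pos.ne'

theorem hasProd_eulerFactor_fredholmDet (hX : BoundedValency X) (hw : ∀ e, 0 < w e)
    (hsum : Summable w) {u : ℂ} (hu : ‖u‖ * ∑' e, w e < 1) :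
    HasProd (eulerFactor w u) (fredholmDet w u)⁻¹ ∧ fredholmDet w u ≠ 0 := by
  have h := fredholmDet_eq_exp hX hw hsum hu
  refine ⟨?_, h ▸ Complex.exp_ne_zero _⟩
  rw [h, ← Complex.exp_neg, neg_neg]
  exact hasProd_eulerFactor (norm_weight_mul_pow_lt_one hw hsum hu)
    (hasSum_nonBacktrackingPath hw hsum hu)

end WeightedGraph

/-! ### The meromorphic continuation -/

/-- By the identity theorem D vanishes to finite order everywhere, and inversion negates a
nonnegative order. Orders are used because the pointwise inverse takes the default value 0 at poles,
which is not a zero of the meromorphic function. -/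
theorem meromorphicOrderAt_inv_nonpos {D : ℂ → ℂ} (hD : Differentiable ℂ D) {z₀ : ℂ}
    (h0 : D z₀ ≠ 0) (z : ℂ) : meromorphicOrderAt (fun u => (D u)⁻¹) z ≤ 0 := by
  have han : AnalyticOnNhd ℂ D Set.univ := fun z _ => hD.analyticAt z
  have hne : meromorphicOrderAt D z ≠ ⊤ := by
    intro h
    rw [meromorphicOrderAt_eq_top_iff] at h
    have := han.eqOn_zero_of_preconnected_of_frequently_eq_zero isPreconnected_univ
      (Set.mem_univ z) h.frequently
    exact h0 (this (Set.mem_univ z₀))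
  have hnn := (hD.analyticAt z).meromorphicOrderAt_nonneg
  have hinv : meromorphicOrderAt (fun u => (D u)⁻¹) z = -meromorphicOrderAt D z :=
    meromorphicOrderAt_inv
  rw [hinv]
  lift meromorphicOrderAt D z to ℤ using hne with n
  norm_cast at hnn ⊢
  omega
end

theorem theorem1p1 {V : Type*} (X : SimpleGraph V) (hconn : X.Connected)
    (hval : WeightedGraph.BoundedValency X)
    (w : X.Dart → ℝ) (hpos : ∀ e, 0 < w e) (hfin : Summable w) :
    TraceClass.IsTraceClass (WeightedGraph.transferOp w) ∧
    ∃ Z : ℂ → ℂ,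
      -- the Euler product converges (to a nonzero limit) for small `|u|`, with limit `Z u`
      (∃ r : ℝ, 0 < r ∧ ∀ u : ℂ, ‖u‖ < r →
        HasProd (WeightedGraph.eulerFactor w u) (Z u) ∧ Z u ≠ 0) ∧
      -- `Z` is meromorphic on the plane and has no zeros
      Meromorphic Z ∧ (∀ u : ℂ, meromorphicOrderAt Z u ≤ 0) ∧
      -- `1 / Z` (with value `0` at the poles of `Z`, where `Z u = 0` by convention) is entire
      -- and equals the Fredholm determinant `det (1 - u T)`
      Differentiable ℂ (fun u => (Z u)⁻¹) ∧
      ∀ u : ℂ, TraceClass.HasFredholmDet (u • WeightedGraph.transferOp w) (Z u)⁻¹ := by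
  have hD := WeightedGraph.differentiable_fredholmDet hval hpos hfin
  have hW : 0 ≤ ∑' e, w e := tsum_nonneg fun e => (hpos e).le
  refine ⟨WeightedGraph.isTraceClass_transferOp hval hpos hfin,
    fun u => (WeightedGraph.fredholmDet w u)⁻¹,
    -- Adding 1 to the total weight keeps the radius meaningful for a graph without edges, whose
    -- total weight is 0.
    ⟨(∑' e, w e + 1)⁻¹, by positivity, fun u hu => ?_⟩,
    fun u => (hD.analyticAt u).meromorphicAt.inv,
    meromorphicOrderAt_inv_nonpos hD (z₀ := 0) ?_, by simpa only [inv_inv] using hD,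
    by simpa only [inv_inv] using
      WeightedGraph.hasFredholmDet_smul_transferOp hval hpos hfin⟩
  · have h1 : ‖u‖ * ∑' e, w e < 1 := by
      have h2 : ‖u‖ * (∑' e, w e + 1) < 1 := by
        rwa [← lt_div_iff₀ (by positivity), one_div]
      nlinarith [norm_nonneg u]
    obtain ⟨h3, h4⟩ := WeightedGraph.hasProd_eulerFactor_fredholmDet hval hpos hfin h1
    exact ⟨h3, inv_ne_zero h4⟩
  -- The point u = 0 satisfies the smallness condition, so D(0) ≠ 0 and D is not identically zero.
  · exact (WeightedGraph.hasProd_eulerFactor_fredholmDet hval hpos hfin (u := 0) (by simp)).2
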